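/- Let $d\ge 3$, let $\sigma$ be the surface measure of the unit sphere $\mathbb{S}^{d-1}\subset\mathbb{R}^d$, $|\mathbb{S}^{d-1}|=\sigma(\mathbb{S}^{d-1})$, and let $\Delta$ be the Laplace--Beltrami operator of $\mathbb{S}^{d-1}$, with unitary group $\mathrm{e}^{\mathrm{i}t\Delta}$ on $L^2(\mathbb{S}^{d-1},\sigma)$. For $k\ge 0$ let $N_{k,d}=\frac{(2k+d-2)(k+d-3)!}{k!\,(d-2)!}$ and let $P_{k,d}$ be defined by $\sum_{k\ge 0} r^kN_{k,d}P_{k,d}(t)=\frac{1-r^2}{(1+r^2-2rt)^{d/2}}$ ($|r|<1$, $|t|\le 1$). For $\xi,\eta\in\mathbb{S}^{d-1}$ and $n\ge0$ put $$Z_\xi^{(k)}(\eta)=\frac{N_{k,d}}{|\mathbb{S}^{d-1}|}P_{k,d}(\xi\cdot\eta),\qquad \mu_{n,k,d}=\frac{n!\,(n+d-2)!}{(n-k)!\,(n+k+d-2)!}\quad(0\le k\le n),$$ $$R_\xi^{(n)}=\sum_{k=0}^n\mu_{n,k,d}Z_\xi^{(k)},\qquad M_{n,d}=\sum_{k=0}^n\mu_{n,k,d}^2\frac{N_{k,d}}{|\mathbb{S}^{d-1}|},\qquad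 S_\xi^{(n)}=\frac{1}{\sqrt{M_{n,d}}}R_\xi^{(n)}.$$ Fix $\xi\in\mathbb{S}^{d-1}$. Then the following hold. 1. The $S_\xi^{(n)}$ are normalized approximate Dirac masses: $\|S_\xi^{(n)}\|_{L^2}=1$ for all $n$, and for every continuous $f:\mathbb{S}^{d-1}\to\mathbb{C}$, $\int R_\zeta^{(n)}f\,\mathrm{d}\sigma\to f(\zeta)$ as $n\to\infty$, uniformly in $\zeta\in\mathbb{S}^{d-1}$. 2. For every $n$ the function $(t,\eta)\mapsto(\mathrm{e}^{\mathrm{i}t\Delta}S_\xi^{(n)})(\eta)$ has a continuous version on $\mathbb{R}\times\mathbb{S}^{d-1}$; with this version, the limit $$p_\xi^{(n)}(\eta)=\lim_{T\to\infty}\frac1T\int_0^T|\mathrm{e}^{\mathrm{i}t\Delta}S_\xi^{(n)}(\eta)|^2\,\mathrm{d}t$$ exists for every $\eta$, is continuous in $\eta$, and $\int p_\xi^{(n)}\,\mathrm{d}\sigma=1$. The densities $p_\xi^{(n)}$ do not equidistribute as $n\to\infty$: it is not true that $\int a\,p_\xi^{(n)}\,\mathrm{d}\sigma\to\frac{1}{|\mathbb{S}^{d-1}|}\int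 a\,\mathrm{d}\sigma$ for every continuous $a:\mathbb{S}^{d-1}\to\mathbb{R}$. Moreover $p_\xi^{(n)}(\xi)\to\infty$ and $p_\xi^{(n)}(-\xi)\to\infty$ as $n\to\infty$, while for every $\eta\ne\pm\xi$ the sequence $(p_\xi^{(n)}(\eta))_n$ is bounded. 3. Let $d=3$ and $a(\eta)=(\xi\cdot\eta)^2$. For every $n$ the limit $$A_n=\lim_{T\to\infty}\frac1T\int_0^T\langle\mathrm{e}^{\mathrm{i}t\Delta}S_\xi^{(n)},a\,\mathrm{e}^{\mathrm{i}t\Delta}S_\xi^{(n)}\rangle\,\mathrm{d}t$$ exists, and $\liminf_{n\to\infty}A_n\ge\frac12$, whereas $\frac{1}{|\mathbb{S}^2|}\int a\,\mathrm{d}\sigma=\frac13$. In particular $A_n$ does not converge to the uniform average of $a$. -/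

import Mathlib

open MeasureTheory Filter Topology
open scoped Laplacian ContDiff

noncomputable section

namespace SphereFlow

/-- The unit sphere of `ℝ^d`. -/
abbrev Sph (d : ℕ) : Type := Metric.sphere (0 : EuclideanSpace ℝ (Fin d)) 1

/-- The (unnormalized) surface measure of the unit sphere of `ℝ^d`. -/
abbrev surf (d : ℕ) : Measure (Sph d) :=
  (volume : Measure (EuclideanSpace ℝ (Fin d))).toSphere

/-- The Euclidean inner product of two points of the sphere. -/
def dot {d : ℕ} (ξ η : Sph d) : ℝ :=
  inner ℝ (ξ : EuclideanSpace ℝ (Fin d)) (η : EuclideanSpace ℝ (Fin d))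

/-! ### The Laplace–Beltrami operator and its unitary group -/

/-- The extension of a function on the sphere to `ℝ^d` that is constant on open rays from the
origin, `x ↦ f (x / ‖x‖)` (with the irrelevant value `0` at the origin). -/
def radialExt {d : ℕ} (f : Sph d → ℂ) (x : EuclideanSpace ℝ (Fin d)) : ℂ :=
  open Classical in
  if h : x = 0 then 0
  else f ⟨‖x‖⁻¹ • x, by
    rw [mem_sphere_zero_iff_norm, norm_smul, norm_inv, norm_norm,
      inv_mul_cancel₀ (norm_ne_zero_iff.mpr h)]⟩

/-- Smoothness of a function on the sphere. -/
def SmoothOnSphere {d : ℕ} (f : Sph d → ℂ) : Prop :=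
  ContDiffOn ℝ ∞ (radialExt f) {0}ᶜ

/-- The Laplace–Beltrami operator of the round sphere (on smooth functions): the Euclidean
Laplacian of the radially constant extension, evaluated on the sphere. -/
def sphereLaplacian {d : ℕ} (f : Sph d → ℂ) (η : Sph d) : ℂ :=
  (Δ (radialExt f)) (η : EuclideanSpace ℝ (Fin d))

/-- The closed subspace of `L²` of the eigenfunctions of `-Δ` with eigenvalue `lam`. -/
def eigenspace (d : ℕ) (lam : ℝ) : Submodule ℂ (Lp ℂ 2 (surf d)) :=
  (Submodule.span ℂ {F : Lp ℂ 2 (surf d) | ∃ f : Sph d → ℂ, SmoothOnSphere f ∧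
    (∀ η, sphereLaplacian f η = -(lam : ℂ) * f η) ∧ F =ᵐ[surf d] f}).topologicalClosure

instance (d : ℕ) (lam : ℝ) : CompleteSpace (eigenspace d lam) :=
  (Submodule.isClosed_topologicalClosure _).completeSpace_coe

/-- The Schrödinger group `exp (i t Δ)` on `L²` of the sphere, by the spectral decomposition of
`Δ`: the sum over all `lam` of `exp (-i t lam)` times the orthogonal projection on the eigenspace
of `-Δ` for `lam` (these spaces are mutually orthogonal, so that the sum converges in `L²`). -/
def schrodinger (d : ℕ) (t : ℝ) (ψ : Lp ℂ 2 (surf d)) : Lp ℂ 2 (surf d) :=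
  ∑' lam : ℝ, Complex.exp (-(Complex.I * t * lam)) • (eigenspace d lam).starProjection ψ

/-- The expectation `⟨ψ, a ψ⟩ = ∫ a |ψ|²` of a real observable `a`. -/
def expectation {d : ℕ} (a : Sph d → ℝ) (ψ : Lp ℂ 2 (surf d)) : ℝ :=
  ∫ η, a η * ‖ψ η‖ ^ 2 ∂(surf d)

/-! ### Zonal harmonics and the approximate Dirac masses -/

/-- The dimension `N_{k,d}` of the space of spherical harmonics of degree `k`, for `d ≥ 3`. -/
def harmDim (d k : ℕ) : ℝ :=
  (2 * k + d - 2 : ℝ) * ((k + d - 3).factorial : ℝ) /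
    ((k.factorial : ℝ) * ((d - 2).factorial : ℝ))

/-- The Poisson kernel `(1 - r²) / (1 + r² - 2 r t)^{d/2}`. -/
def spherePoisson (d : ℕ) (t r : ℝ) : ℝ :=
  (1 - r ^ 2) / (1 + r ^ 2 - 2 * r * t) ^ ((d : ℝ) / 2)

/-- The Legendre polynomial `P_{k,d}`, defined by the Poisson identity
`∑ r^k N_{k,d} P_{k,d}(t) = (1 - r²) / (1 + r² - 2 r t)^{d/2}`, that is, `N_{k,d} P_{k,d}(t)` is the
Taylor coefficient of order `k` at `r = 0` of the right-hand side. -/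
def legendre (d k : ℕ) (t : ℝ) : ℝ :=
  iteratedDeriv k (spherePoisson d t) 0 / (k.factorial : ℝ) / harmDim d k

/-- The zonal harmonic `Z_ξ^{(k)}(η) = N_{k,d} / |S^{d-1}| * P_{k,d}(ξ · η)`. -/
def zonal (d k : ℕ) (ξ η : Sph d) : ℝ :=
  harmDim d k / (surf d).real Set.univ * legendre d k (dot ξ η)

/-- The weights `μ_{n,k,d}` (for `k ≤ n`). -/
def weight (d n k : ℕ) : ℝ :=
  ((n.factorial : ℝ) * ((n + d - 2).factorial : ℝ)) /
    (((n - k).factorial : ℝ) * ((n + k + d - 2).factorial : ℝ))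

/-- The unnormalized approximate Dirac mass `R_ξ^{(n)}`. -/
def diracKernel (d n : ℕ) (ξ η : Sph d) : ℝ :=
  ∑ k ∈ Finset.range (n + 1), weight d n k * zonal d k ξ η

/-- The constant `M_{n,d}`. -/
def normConst (d n : ℕ) : ℝ :=
  ∑ k ∈ Finset.range (n + 1), weight d n k ^ 2 * (harmDim d k / (surf d).real Set.univ)

/-- The normalized approximate Dirac mass `S_ξ^{(n)} = M_{n,d}^{-1/2} R_ξ^{(n)}`. -/
def diracMass (d n : ℕ) (ξ η : Sph d) : ℂ :=
  ((diracKernel d n ξ η / √(normConst d n) : ℝ) : ℂ)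

end SphereFlow

end

open SphereFlow

/-!
Everything reduces to polynomials in the variable `t = ξ · η`. The generating function identifies
the Legendre polynomials with Gegenbauer polynomials; these satisfy a differential equation, so the
zonal harmonics are eigenfunctions of `-Δ` with eigenvalues `k (k + d - 2)`, and a three-term
recurrence. Eigenfunctions with distinct eigenvalues are orthogonal by Green's formula in `ℝ^d`,
applied to their radially constant extensions cut off to an annulus. Normalized for the uniform
probability measure of the sphere, the zonal harmonics are thus an orthonormal sequence `p_k` with
`t p_k = c_k p_{k+1} + c_{k-1} p_{k-1}`, where `c_k² - 1/4` is summable.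

The recurrence collapses the sum defining `R_ζ^{(n)}` to a multiple of the positive power
`((1 + ζ · η) / 2)^n`, which concentrates at `ζ`.

As the eigenvalues are distinct, time averaging removes the cross terms of
`|exp (i t Δ) S_ξ^{(n)}|²` and leaves `∑ w_k p_k² / |S|`, where `w_k = w_{n,k}` is the distribution
of the degree in `S_ξ^{(n)}`. For each fixed `k` it tends to `0` as `n → ∞`, because
`M_{n,d} → ∞`. Hence the long-time averages behave as `p_k²` does for large `k`: at the poles
`p_k² = N_{k,d} → ∞`; elsewhere `p_k²` stays bounded, since the quadratic form
`c_k² (p_{k+1}² + p_k²) - t c_k p_{k+1} p_k` is positive definite for large `k` if `|t| < 1` and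
grows with `k` only by summable relative amounts; and the mean of `t² p_k²` is `c_k² + c_{k-1}²`,
which tends to `1/2`, whereas the uniform mean of `t²` is `1/d`.
-/

noncomputable section

namespace SphereFlow

section Gegenbauer

open Polynomial

variable {K : Type*} [Field K]

/-- The Gegenbauer (ultraspherical) polynomials `C_k^{(s)}`, defined by their three-term
recurrence. -/
def gegenbauer (s : K) : ℕ → K[X]
  | 0 => 1
  | 1 => 2 * C s * X
  | k + 2 => C ((k + 2 : K)⁻¹) *
      (C (2 * (k + 1 + s)) * X * gegenbauer s (k + 1) - C (k + 2 * s) * gegenbauer s k)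

theorem gegenbauer_zero (s : K) : gegenbauer s 0 = 1 := rfl

theorem gegenbauer_one (s : K) : gegenbauer s 1 = 2 * C s * X := rfl

variable [CharZero K] (s : K) (k : ℕ)

theorem gegenbauer_add_two :
    (k + 2 : K[X]) * gegenbauer s (k + 2) =
      2 * ((k : K[X]) + 1 + C s) * X * gegenbauer s (k + 1) -
        ((k : K[X]) + 2 * C s) * gegenbauer s k := by
  have hk : (k + 2 : K) ≠ 0 := by exact_mod_cast (k + 1).succ_ne_zero
  have hC : (k + 2 : K[X]) * C ((k + 2 : K)⁻¹) = 1 := by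
    rw [← C_eq_natCast, ← C_ofNat, ← C_add, ← C_mul, mul_inv_cancel₀ hk, C_1]
  rw [gegenbauer, ← mul_assoc, hC, one_mul]
  simp only [map_add, map_mul, map_natCast, map_ofNat, map_one]

theorem derivative_gegenbauer_add_two :
    (k + 2 : K[X]) * derivative (gegenbauer s (k + 2)) =
      2 * ((k : K[X]) + 1 + C s) * (gegenbauer s (k + 1) + X * derivative (gegenbauer s (k + 1))) -
        ((k : K[X]) + 2 * C s) * derivative (gegenbauer s k) := by
  have h := congrArg derivative (gegenbauer_add_two s k)
  simp only [derivative_mul, derivative_sub, derivative_add, derivative_natCast,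
    derivative_ofNat, derivative_one, derivative_C, derivative_X] at h
  linear_combination h

theorem derivative_gegenbauer_relations :
    X * derivative (gegenbauer s (k + 1)) - derivative (gegenbauer s k) =
      ((k : K[X]) + 1) * gegenbauer s (k + 1) ∧
    derivative (gegenbauer s (k + 1)) - X * derivative (gegenbauer s k) =
      ((k : K[X]) + 2 * C s) * gegenbauer s k := by
  induction k with
  | zero => simp [gegenbauer_zero, gegenbauer_one, mul_comm]
  | succ k ih =>
    obtain ⟨hX, hC⟩ := ih
    have hk : (k + 2 : K[X]) ≠ 0 := by exact_mod_cast (k + 1).succ_ne_zero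
    have hsucc : derivative (gegenbauer s (k + 2)) - X * derivative (gegenbauer s (k + 1)) =
        ((k : K[X]) + 1 + 2 * C s) * gegenbauer s (k + 1) := by
      apply mul_left_cancel₀ hk
      linear_combination derivative_gegenbauer_add_two s k + ((k : K[X]) + 2 * C s) * hX
    push_cast
    exact ⟨by linear_combination X * hsucc + X * hX - hC - gegenbauer_add_two s k,
      by linear_combination hsucc⟩

theorem gegenbauer_ode :
    (1 - X ^ 2) * derivative (derivative (gegenbauer s k)) -
      (2 * C s + 1) * X * derivative (gegenbauer s k) +
      (k : K[X]) * ((k : K[X]) + 2 * C s) * gegenbauer s k = 0 := by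
  obtain ⟨hX, hC⟩ := derivative_gegenbauer_relations s k
  have hD : (1 - X ^ 2) * derivative (gegenbauer s k) =
      ((k : K[X]) + 2 * C s) * X * gegenbauer s k - ((k : K[X]) + 1) * gegenbauer s (k + 1) := by
    linear_combination X * hC - hX
  have h := congrArg derivative hD
  simp only [derivative_mul, derivative_sub, derivative_add, derivative_natCast, derivative_ofNat,
    derivative_one, derivative_C, derivative_X, derivative_X_pow, Nat.cast_ofNat, map_ofNat,
    Nat.reduceSub, pow_one] at h
  linear_combination h - ((k : K[X]) + 1) * hC

end Gegenbauer

section GeneratingFunction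

theorem iteratedDeriv_succ_id_mul_zero {𝕜 : Type*} [NontriviallyNormedField 𝕜] {f : 𝕜 → 𝕜}
    {k : ℕ} (hf : ContDiffAt 𝕜 (k + 1) f 0) :
    iteratedDeriv (k + 1) (fun r => r * f r) 0 = (k + 1) * iteratedDeriv k f 0 := by
  rw [iteratedDeriv_fun_mul (f := fun r : 𝕜 => r) contDiffAt_id (mod_cast hf),
    Finset.sum_eq_single 1 (fun i _ hi => by simp [iteratedDeriv_fun_id_zero, hi]) (by simp)]
  simp [iteratedDeriv_fun_id_zero]

theorem iteratedDeriv_id_mul_deriv_zero {𝕜 : Type*} [NontriviallyNormedField 𝕜]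
    {f : 𝕜 → 𝕜} {k : ℕ} (hf : ContDiffAt 𝕜 (k + 1) f 0) :
    iteratedDeriv k (fun r => r * deriv f r) 0 = k * iteratedDeriv k f 0 := by
  rcases k with _ | k
  · simp
  · rw [iteratedDeriv_succ_id_mul_zero (hf.derivWithin (mod_cast le_rfl)), iteratedDeriv_succ']
    push_cast
    rfl

/-- The generating function `r ↦ (1 + r² - 2 r t)^{-s}` of the Gegenbauer polynomials
`C_k^{(s)}(t)`. -/
def gegenbauerGen (s t r : ℝ) : ℝ := (1 + r ^ 2 - 2 * r * t) ^ (-s)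

variable (s t : ℝ)

theorem eventually_gegenbauerGen_base_pos : ∀ᶠ r : ℝ in 𝓝 0, 0 < 1 + r ^ 2 - 2 * r * t :=
  (show ContinuousAt (fun r : ℝ => 1 + r ^ 2 - 2 * r * t) 0 by fun_prop).eventually_const_lt
    (by simp)

theorem contDiffAt_gegenbauerGen {n : WithTop ℕ∞} : ContDiffAt ℝ n (gegenbauerGen s t) 0 :=
  ContDiffAt.rpow_const_of_ne (by fun_prop) (by simp)

theorem hasDerivAt_gegenbauerGen {r : ℝ} (hr : 0 < 1 + r ^ 2 - 2 * r * t) :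
    HasDerivAt (gegenbauerGen s t)
      (2 * s * (t - r) * (1 + r ^ 2 - 2 * r * t) ^ (-s - 1)) r := by
  have h : HasDerivAt (fun r : ℝ => 1 + r ^ 2 - 2 * r * t) (2 * r - 2 * t) r := by
    simpa using ((hasDerivAt_pow 2 r).const_add 1).fun_sub
      (((hasDerivAt_id' r).const_mul 2).mul_const t)
  exact (h.rpow_const (p := -s) (.inl hr.ne')).congr_deriv (by ring)

theorem gegenbauerGen_ode {r : ℝ} (hr : 0 < 1 + r ^ 2 - 2 * r * t) :
    deriv (gegenbauerGen s t) r + r * (r * deriv (gegenbauerGen s t) r) -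
        2 * t * (r * deriv (gegenbauerGen s t) r) =
      2 * s * t * gegenbauerGen s t r - 2 * s * (r * gegenbauerGen s t r) := by
  have hpow : gegenbauerGen s t r =
      (1 + r ^ 2 - 2 * r * t) ^ (-s - 1) * (1 + r ^ 2 - 2 * r * t) := by
    rw [Real.rpow_sub_one hr.ne', div_mul_cancel₀ _ hr.ne', gegenbauerGen]
  rw [(hasDerivAt_gegenbauerGen s t hr).deriv, hpow]
  ring

theorem iteratedDeriv_gegenbauerGen_add_two (k : ℕ) :
    iteratedDeriv (k + 2) (gegenbauerGen s t) 0 =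
      2 * (k + 1 + s) * t * iteratedDeriv (k + 1) (gegenbauerGen s t) 0 -
        (k + 1) * (k + 2 * s) * iteratedDeriv k (gegenbauerGen s t) 0 := by
  have hg {n : ℕ} : ContDiffAt ℝ n (gegenbauerGen s t) 0 := contDiffAt_gegenbauerGen s t
  have hg' {n : ℕ} : ContDiffAt ℝ n (deriv (gegenbauerGen s t)) 0 :=
    (contDiffAt_gegenbauerGen (n := n + 1) s t).derivWithin le_rfl
  have hid {n : ℕ} {f : ℝ → ℝ} (hf : ContDiffAt ℝ n f 0) : ContDiffAt ℝ n (fun r => r * f r) 0 :=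
    contDiffAt_id.mul hf
  have h := Filter.EventuallyEq.iteratedDeriv_eq (k + 1) (x := (0 : ℝ))
    ((eventually_gegenbauerGen_base_pos t).mono fun r hr => gegenbauerGen_ode s t hr)
  rw [iteratedDeriv_fun_sub (hg'.add (hid (hid hg'))) (contDiffAt_const.mul (hid hg')),
    iteratedDeriv_fun_add hg' (hid (hid hg')),
    iteratedDeriv_succ_id_mul_zero (hid hg'), iteratedDeriv_id_mul_deriv_zero hg,
    iteratedDeriv_fun_sub (contDiffAt_const.mul hg) (contDiffAt_const.mul (hid hg)),
    iteratedDeriv_const_mul_field, iteratedDeriv_const_mul_field, iteratedDeriv_const_mul_field,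
    iteratedDeriv_id_mul_deriv_zero hg, iteratedDeriv_succ_id_mul_zero hg,
    ← iteratedDeriv_succ'] at h
  push_cast at h
  linear_combination h

theorem iteratedDeriv_gegenbauerGen (k : ℕ) :
    iteratedDeriv k (gegenbauerGen s t) 0 = k.factorial * (gegenbauer s k).eval t := by
  induction k using Nat.twoStepInduction with
  | zero => simp [gegenbauerGen, gegenbauer_zero]
  | one =>
    rw [iteratedDeriv_one, (hasDerivAt_gegenbauerGen s t (by simp)).deriv]
    simp [gegenbauer_one]
  | more k ih ih' =>
    have h := congrArg (Polynomial.eval t) (gegenbauer_add_two s k)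
    simp only [Polynomial.eval_mul, Polynomial.eval_sub, Polynomial.eval_add, Polynomial.eval_C,
      Polynomial.eval_X, Polynomial.eval_natCast, Polynomial.eval_ofNat, Polynomial.eval_one] at h
    rw [iteratedDeriv_gegenbauerGen_add_two, ih, ih', Nat.factorial_succ (k + 1),
      Nat.factorial_succ k]
    push_cast
    linear_combination -((k + 1 : ℝ) * k.factorial) * h

end GeneratingFunction

section ZonalPolynomials

open Polynomial

/-- The index `(d - 2) / 2` of the Gegenbauer polynomials belonging to the sphere of `ℝ^d`. -/
def gegIndex (d : ℕ) : ℝ := ((d : ℝ) - 2) / 2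

/-- The polynomial `N_{k,d} P_{k,d}`, written as a multiple of a Gegenbauer polynomial. -/
def zonalPoly (d k : ℕ) : ℝ[X] :=
  C ((k + gegIndex d) / gegIndex d) * gegenbauer (gegIndex d) k

/-- The coefficient of `N_{k+1} P_{k+1}` in the expansion of `X * (N_k P_k)`. -/
def zonalUp (d k : ℕ) : ℝ := (k + 1) / (2 * k + d)

/-- The coefficient of `N_k P_k` in the expansion of `X * (N_{k+1} P_{k+1})`. -/
def zonalDown (d k : ℕ) : ℝ := (k + d - 2) / (2 * k + d - 2)

theorem two_mul_gegIndex (d : ℕ) : 2 * gegIndex d = d - 2 := by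
  unfold gegIndex
  ring

variable {d : ℕ}

theorem zonalPoly_ode (k : ℕ) :
    (1 - X ^ 2) * derivative (derivative (zonalPoly d k)) -
      ((d : ℝ[X]) - 1) * X * derivative (zonalPoly d k) =
      -((k : ℝ[X]) * ((k : ℝ[X]) + (d : ℝ[X]) - 2)) * zonalPoly d k := by
  have hd : (d : ℝ[X]) = 2 * C (gegIndex d) + 2 := by
    rw [← C_ofNat, ← C_mul, two_mul_gegIndex, C_sub, C_ofNat, C_eq_natCast]
    ring
  simp only [zonalPoly, derivative_C_mul, hd]
  linear_combination C ((k + gegIndex d) / gegIndex d) * gegenbauer_ode (gegIndex d) k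

theorem gegIndex_pos (hd : 3 ≤ d) : 0 < gegIndex d := by
  have : (3 : ℝ) ≤ d := mod_cast hd
  unfold gegIndex
  linarith

theorem iteratedDeriv_spherePoisson (hd : 3 ≤ d) (k : ℕ) (t : ℝ) :
    iteratedDeriv k (spherePoisson d t) 0 = k.factorial * (zonalPoly d k).eval t := by
  have hs := gegIndex_pos hd
  have hsd : (d : ℝ) / 2 = -(-gegIndex d - 1) := by linear_combination -two_mul_gegIndex d / 2
  have hgen : spherePoisson d t =ᶠ[𝓝 0] fun r => gegenbauerGen (gegIndex d) t r +
      1 / gegIndex d * (r * deriv (gegenbauerGen (gegIndex d) t) r) := by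
    filter_upwards [eventually_gegenbauerGen_base_pos t] with r hr
    rw [(hasDerivAt_gegenbauerGen _ t hr).deriv, gegenbauerGen, spherePoisson, hsd,
      Real.rpow_neg hr.le, div_inv_eq_mul,
      show -gegIndex d = -gegIndex d - 1 + 1 by ring, Real.rpow_add_one hr.ne',
      show -gegIndex d - 1 + 1 - 1 = -gegIndex d - 1 by ring]
    field_simp
    ring
  have hg {n : ℕ} : ContDiffAt ℝ n (gegenbauerGen (gegIndex d) t) 0 :=
    contDiffAt_gegenbauerGen _ t
  have hg' : ContDiffAt ℝ k (deriv (gegenbauerGen (gegIndex d) t)) 0 :=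
    (hg (n := k + 1)).derivWithin (mod_cast le_rfl)
  have hid : ContDiffAt ℝ k (fun r : ℝ => r) 0 := contDiffAt_id
  rw [hgen.iteratedDeriv_eq, iteratedDeriv_fun_add hg (contDiffAt_const.mul (hid.mul hg')),
    iteratedDeriv_const_mul_field, iteratedDeriv_id_mul_deriv_zero hg,
    iteratedDeriv_gegenbauerGen, zonalPoly, eval_mul, eval_C]
  field_simp
  ring

theorem zonalPoly_zero (hd : 3 ≤ d) : zonalPoly d 0 = 1 := by
  simp [zonalPoly, gegenbauer_zero, (gegIndex_pos hd).ne']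

theorem X_mul_zonalPoly_zero (hd : 3 ≤ d) :
    X * zonalPoly d 0 = C (zonalUp d 0) * zonalPoly d 1 := by
  have hs := gegIndex_pos hd
  have hsd : (d : ℝ) = 2 * gegIndex d + 2 := by rw [two_mul_gegIndex]; ring
  refine funext fun t => ?_
  simp only [zonalPoly, gegenbauer_zero, gegenbauer_one, zonalUp, hsd, eval_mul, eval_C, eval_X,
    eval_one, eval_ofNat, Nat.cast_zero, Nat.cast_one]
  field_simp
  ring

theorem X_mul_zonalPoly_succ (hd : 3 ≤ d) (k : ℕ) :
    X * zonalPoly d (k + 1) =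
      C (zonalUp d (k + 1)) * zonalPoly d (k + 2) + C (zonalDown d k) * zonalPoly d k := by
  have hs := gegIndex_pos hd
  have hsd : (d : ℝ) = 2 * gegIndex d + 2 := by rw [two_mul_gegIndex]; ring
  have hup : zonalUp d (k + 1) * (k + 2 + gegIndex d) = (k + 2) / 2 := by
    rw [zonalUp, hsd]
    push_cast
    field_simp
    ring
  have hdown : zonalDown d k * (k + gegIndex d) = (k + 2 * gegIndex d) / 2 := by
    rw [zonalDown, hsd, show k + (2 * gegIndex d + 2) - 2 = k + 2 * gegIndex d by ring,
      show 2 * (k : ℝ) + (2 * gegIndex d + 2) - 2 = 2 * (k + gegIndex d) by ring]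
    field_simp
  refine funext fun t => ?_
  have hrec := congrArg (eval t) (gegenbauer_add_two (gegIndex d) k)
  simp only [eval_mul, eval_sub, eval_add, eval_C, eval_X, eval_natCast, eval_ofNat,
    eval_one] at hrec
  simp only [zonalPoly, eval_mul, eval_add, eval_C, eval_X]
  push_cast
  field_simp
  linear_combination -(gegenbauer (gegIndex d) (k + 2)).eval t * hup
    - (gegenbauer (gegIndex d) k).eval t * hdown - hrec / 2

theorem zonalUp_pos (hd : 3 ≤ d) (k : ℕ) : 0 < zonalUp d k := by
  have : 0 < (d : ℝ) := mod_cast (by omega : 0 < d)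
  unfold zonalUp
  positivity

theorem zonalDown_pos (hd : 3 ≤ d) (k : ℕ) : 0 < zonalDown d k := by
  have : (3 : ℝ) ≤ d := mod_cast hd
  have : (0 : ℝ) ≤ k := k.cast_nonneg
  exact div_pos (by linarith) (by linarith)

theorem zonalDown_zero (hd : 3 ≤ d) : zonalDown d 0 = 1 := by
  have : (3 : ℝ) ≤ d := mod_cast hd
  simpa [zonalDown] using div_self (by linarith : (d : ℝ) - 2 ≠ 0)

theorem zonalDown_succ_add_zonalUp (hd : 3 ≤ d) (k : ℕ) :
    zonalDown d (k + 1) + zonalUp d k = 1 := by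
  have : 0 < (d : ℝ) := mod_cast (by omega : 0 < d)
  have hden : 2 * ((k + 1 : ℕ) : ℝ) + d - 2 = 2 * k + d := by push_cast; ring
  rw [zonalDown, zonalUp, hden, ← add_div, div_eq_one_iff_eq (by positivity)]
  push_cast
  ring

end ZonalPolynomials

section HarmonicDimension

variable {d : ℕ}

theorem harmDim_zero (hd : 3 ≤ d) : harmDim d 0 = 1 := by
  have hfact : ((d - 2).factorial : ℝ) = (d - 2) * (d - 3).factorial := by
    rw [show d - 2 = d - 3 + 1 by omega, Nat.factorial_succ]
    push_cast [Nat.cast_sub hd]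
    ring
  have : (3 : ℝ) ≤ d := mod_cast hd
  have hne : ((d : ℝ) - 2) * (d - 3).factorial ≠ 0 :=
    mul_ne_zero (by linarith) (by positivity)
  simp [harmDim, hfact, div_self hne]

theorem harmDim_pos (hd : 3 ≤ d) (k : ℕ) : 0 < harmDim d k := by
  have : (3 : ℝ) ≤ d := mod_cast hd
  have : (0 : ℝ) < 2 * k + d - 2 := by linarith [k.cast_nonneg (α := ℝ)]
  unfold harmDim
  positivity

theorem zonalUp_mul_harmDim_succ (hd : 3 ≤ d) (k : ℕ) :
    zonalUp d k * harmDim d (k + 1) = zonalDown d k * harmDim d k := by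
  obtain ⟨m, rfl⟩ := Nat.exists_eq_add_of_le' hd
  simp only [harmDim, zonalUp, zonalDown, show k + 1 + (m + 3) - 3 = k + m + 1 by omega,
    show k + (m + 3) - 3 = k + m by omega, Nat.factorial_succ]
  push_cast
  rw [show 2 * (k + 1 : ℝ) + (m + 3) - 2 = 2 * k + (m + 3) by ring,
    show 2 * (k : ℝ) + (m + 3) - 2 = 2 * k + m + 1 by ring,
    show (k : ℝ) + (m + 3) - 2 = k + m + 1 by ring]
  field_simp

theorem zonalPoly_eval_of_sq_eq_one (hd : 3 ≤ d) {t : ℝ} (ht : t ^ 2 = 1) (k : ℕ) :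
    (zonalPoly d k).eval t = t ^ k * harmDim d k := by
  induction k using Nat.twoStepInduction with
  | zero => simp [zonalPoly_zero hd, harmDim_zero hd]
  | one =>
    have h := congrArg (Polynomial.eval t) (X_mul_zonalPoly_zero hd)
    have hN := zonalUp_mul_harmDim_succ hd 0
    simp only [zonalPoly_zero hd, Polynomial.eval_mul, Polynomial.eval_X, Polynomial.eval_C,
      Polynomial.eval_one] at h
    rw [harmDim_zero hd, zonalDown_zero hd] at hN
    apply mul_left_cancel₀ (zonalUp_pos hd 0).ne'
    linear_combination -h - t * hN
  | more k ih ih' =>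
    have h := congrArg (Polynomial.eval t) (X_mul_zonalPoly_succ hd k)
    simp only [Polynomial.eval_mul, Polynomial.eval_add, Polynomial.eval_X, Polynomial.eval_C,
      ih, ih'] at h
    apply mul_left_cancel₀ (zonalUp_pos hd (k + 1)).ne'
    linear_combination -h + t ^ k * zonalUp_mul_harmDim_succ hd k
      - t ^ (k + 2) * zonalUp_mul_harmDim_succ hd (k + 1)
      - t ^ (k + 2) * harmDim d (k + 1) * zonalDown_succ_add_zonalUp hd k
      + t ^ k * harmDim d (k + 1) * zonalUp d k * ht

theorem zonal_eq (hd : 3 ≤ d) (k : ℕ) (ξ η : Sph d) :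
    zonal d k ξ η = (zonalPoly d k).eval (dot ξ η) / (surf d).real Set.univ := by
  have hN := (harmDim_pos hd k).ne'
  rw [zonal, legendre, iteratedDeriv_spherePoisson hd]
  field_simp

end HarmonicDimension

section Green

variable {E : Type*} [NormedAddCommGroup E] [InnerProductSpace ℝ E]

theorem integral_fderiv_apply_eq_zero [FiniteDimensional ℝ E] [MeasurableSpace E] [BorelSpace E]
    (μ : Measure E) [μ.IsAddHaarMeasure] {F : Type*} [NormedAddCommGroup F] [NormedSpace ℝ F]
    {h : E → F} (hh : ContDiff ℝ 1 h) (hc : HasCompactSupport h) (v : E) :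
    ∫ x, fderiv ℝ h x v ∂μ = 0 := by
  have hint : Integrable (fun x => fderiv ℝ h x v) μ :=
    ((hh.continuous_fderiv one_ne_zero).clm_apply continuous_const).integrable_of_hasCompactSupport
      (hc.fderiv_apply (𝕜 := ℝ) v)
  simpa using integral_smul_fderiv_eq_neg_fderiv_smul_of_integrable (μ := μ)
    (f := fun _ : E => (1 : ℝ)) (g := h) (v := v) (by simp) (by simpa using hint)
    (by simpa using hh.continuous.integrable_of_hasCompactSupport hc)
    (fun x _ => differentiableAt_const 1) (fun x _ => hh.differentiable one_ne_zero x)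

theorem laplacian_eq_sum_fderiv_fderiv [FiniteDimensional ℝ E] {F : Type*} [NormedAddCommGroup F]
    [NormedSpace ℝ F] {ι : Type*} [Fintype ι] (b : OrthonormalBasis ι ℝ E) (f : E → F) (x : E) :
    (Δ f) x = ∑ i, fderiv ℝ (fderiv ℝ f) x (b i) (b i) := by
  rw [InnerProductSpace.laplacian_eq_iteratedFDeriv_orthonormalBasis f b]
  simp [iteratedFDeriv_two_apply]

/-- The component in the direction `v` of the vector field `X (G ∇F - F ∇G)`, whose divergence is
the integrand of Green's second identity when `∇X` is orthogonal to `∇F` and `∇G`. -/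
def greenField (X : E → ℝ) (F G : E → ℂ) (v x : E) : ℂ :=
  (X x : ℂ) * (G x * fderiv ℝ F x v - F x * fderiv ℝ G x v)

variable {X : E → ℝ} {F G : E → ℂ}

theorem greenField_eventuallyEq_zero {x : E} (hx : x ∉ tsupport X) (v : E) :
    greenField X F G v =ᶠ[𝓝 x] 0 := by
  filter_upwards [notMem_tsupport_iff_eventuallyEq.mp hx] with y hy
  simp [greenField, hy]

theorem contDiff_greenField (hX : ContDiff ℝ 1 X) (hF : ∀ x ∈ tsupport X, ContDiffAt ℝ 2 F x)
    (hG : ∀ x ∈ tsupport X, ContDiffAt ℝ 2 G x) (v : E) : ContDiff ℝ 1 (greenField X F G v) := by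
  rw [contDiff_iff_contDiffAt]
  intro x
  by_cases hx : x ∈ tsupport X
  · have hfd {H : E → ℂ} (hH : ContDiffAt ℝ 2 H x) : ContDiffAt ℝ 1 (fun y => fderiv ℝ H y v) x :=
      (hH.fderiv_right (m := 1) (by norm_num)).clm_apply contDiffAt_const
    have hle {H : E → ℂ} (hH : ContDiffAt ℝ 2 H x) : ContDiffAt ℝ 1 H x :=
      hH.of_le one_le_two
    exact (Complex.ofRealCLM.contDiff.comp hX).contDiffAt.mul
      (((hle (hG x hx)).mul (hfd (hF x hx))).sub ((hle (hF x hx)).mul (hfd (hG x hx))))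
  · exact contDiffAt_const.congr_of_eventuallyEq (greenField_eventuallyEq_zero hx v)

theorem fderiv_greenField {v x : E} (hX : DifferentiableAt ℝ X x) (hF : ContDiffAt ℝ 2 F x)
    (hG : ContDiffAt ℝ 2 G x) :
    fderiv ℝ (greenField X F G v) x v =
      G x * fderiv ℝ F x (fderiv ℝ X x v • v) - F x * fderiv ℝ G x (fderiv ℝ X x v • v) +
        (X x : ℂ) * (G x * fderiv ℝ (fderiv ℝ F) x v v - F x * fderiv ℝ (fderiv ℝ G) x v v) := by
  have hfd {H : E → ℂ} (hH : ContDiffAt ℝ 2 H x) : HasFDerivAt (fun y => fderiv ℝ H y v)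
      ((fderiv ℝ (fderiv ℝ H) x).flip v) x := by
    simpa using ((hH.fderiv_right (m := 1) (by norm_num)).differentiableAt
      one_ne_zero).hasFDerivAt.clm_apply (hasFDerivAt_const v x)
  have hF' := (hF.differentiableAt two_ne_zero).hasFDerivAt
  have hG' := (hG.differentiableAt two_ne_zero).hasFDerivAt
  have hX' : HasFDerivAt (fun y => (X y : ℂ)) (Complex.ofRealCLM.comp (fderiv ℝ X x)) x :=
    Complex.ofRealCLM.hasFDerivAt.comp x hX.hasFDerivAt
  have h : fderiv ℝ (greenField X F G v) x = _ :=
    (hX'.fun_mul ((hG'.fun_mul (hfd hF)).fun_sub (hF'.fun_mul (hfd hG)))).fderiv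
  simp only [h, map_smul, Complex.real_smul, add_apply, smul_apply, sub_apply,
    ContinuousLinearMap.flip_apply, ContinuousLinearMap.comp_apply, Complex.ofRealCLM_apply,
    smul_eq_mul]
  ring

variable [FiniteDimensional ℝ E]

theorem sum_fderiv_greenField {ι : Type*} [Fintype ι] (b : OrthonormalBasis ι ℝ E)
    (hX : ContDiff ℝ 1 X) (hF : ∀ x ∈ tsupport X, ContDiffAt ℝ 2 F x)
    (hG : ∀ x ∈ tsupport X, ContDiffAt ℝ 2 G x)
    (hXF : ∀ x ∈ tsupport X, fderiv ℝ F x (gradient X x) = 0)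
    (hXG : ∀ x ∈ tsupport X, fderiv ℝ G x (gradient X x) = 0) (x : E) :
    ∑ i, fderiv ℝ (greenField X F G (b i)) x (b i) =
      (X x : ℂ) * (G x * (Δ F) x - F x * (Δ G) x) := by
  by_cases hx : x ∈ tsupport X
  · have hgrad : ∑ i, fderiv ℝ X x (b i) • b i = gradient X x := by
      rw [← b.sum_repr' (gradient X x)]
      refine Finset.sum_congr rfl fun i _ => ?_
      rw [real_inner_comm, inner_gradient_left]
    simp only [fderiv_greenField (hX.differentiable one_ne_zero x) (hF x hx) (hG x hx),
      laplacian_eq_sum_fderiv_fderiv b, Finset.sum_add_distrib, Finset.sum_sub_distrib,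
      ← Finset.mul_sum, ← map_sum, hgrad, hXF x hx, hXG x hx]
    ring
  · have hX0 : X x = 0 := image_eq_zero_of_notMem_tsupport hx
    simp [(greenField_eventuallyEq_zero hx _).fderiv_eq, hX0]

theorem integral_mul_laplacian_sub_mul_laplacian_eq_zero [MeasurableSpace E] [BorelSpace E]
    (μ : Measure E) [μ.IsAddHaarMeasure] (hX : ContDiff ℝ 1 X) (hXc : HasCompactSupport X)
    (hF : ∀ x ∈ tsupport X, ContDiffAt ℝ 2 F x) (hG : ∀ x ∈ tsupport X, ContDiffAt ℝ 2 G x)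
    (hXF : ∀ x ∈ tsupport X, fderiv ℝ F x (gradient X x) = 0)
    (hXG : ∀ x ∈ tsupport X, fderiv ℝ G x (gradient X x) = 0) :
    ∫ x, (X x : ℂ) * (G x * (Δ F) x - F x * (Δ G) x) ∂μ = 0 := by
  have hsmooth (v : E) := contDiff_greenField hX hF hG v
  have hcompact (v : E) : HasCompactSupport (greenField X F G v) :=
    hXc.mono fun x hx h => hx (by simp [greenField, h])
  have hint (v : E) : Integrable (fun x => fderiv ℝ (greenField X F G v) x v) μ :=
    (((hsmooth v).continuous_fderiv one_ne_zero).clm_apply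
      continuous_const).integrable_of_hasCompactSupport ((hcompact v).fderiv_apply (𝕜 := ℝ) v)
  let b := stdOrthonormalBasis ℝ E
  simp only [← sum_fderiv_greenField b hX hF hG hXF hXG]
  rw [integral_finsetSum _ fun i _ => hint (b i)]
  exact Finset.sum_eq_zero fun i _ =>
    integral_fderiv_apply_eq_zero μ (hsmooth (b i)) (hcompact (b i)) (b i)

end Green

section RadialCutoff

/-- A bump function on the squared radius, so that `x ↦ annulusBump (‖x‖ ^ 2)` is a smooth radial
cutoff supported in an annulus. -/
def annulusBump : ContDiffBump (2 : ℝ) := ⟨1 / 2, 1, by norm_num, by norm_num⟩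

theorem annulusBump_eq_zero {s : ℝ} (hs : s ≤ 1 ∨ 3 ≤ s) : annulusBump s = 0 := by
  apply annulusBump.zero_of_le_dist
  change (1 : ℝ) ≤ |s - 2|
  rw [le_abs]
  rcases hs with hs | hs
  · right; linarith
  · left; linarith

theorem ne_zero_of_mem_tsupport_mul_annulusBump {E : Type*} [NormedAddCommGroup E]
    {φ : E → ℝ} {x : E} (hx : x ∈ tsupport fun y : E => φ y * annulusBump (‖y‖ ^ 2)) : x ≠ 0 := by
  rintro rfl
  refine notMem_tsupport_iff_eventuallyEq.mpr ?_ hx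
  filter_upwards [Metric.ball_mem_nhds (0 : E) one_pos] with y hy
  rw [mem_ball_zero_iff] at hy
  simp [annulusBump_eq_zero (.inl (pow_le_one₀ (norm_nonneg y) hy.le))]

variable {E : Type*} [NormedAddCommGroup E] [InnerProductSpace ℝ E]

theorem contDiff_annulusBump_norm_sq {n : ℕ∞} : ContDiff ℝ n fun x : E => annulusBump (‖x‖ ^ 2) :=
  annulusBump.contDiff.comp (contDiff_norm_sq ℝ)

theorem hasCompactSupport_annulusBump_norm_sq [FiniteDimensional ℝ E] :
    HasCompactSupport fun x : E => annulusBump (‖x‖ ^ 2) := by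
  refine HasCompactSupport.intro (isCompact_closedBall (0 : E) 2) fun x hx =>
    annulusBump_eq_zero (.inr ?_)
  rw [mem_closedBall_zero_iff, not_le] at hx
  nlinarith

theorem gradient_comp_norm_sq [CompleteSpace E] {φ : ℝ → ℝ} {x : E}
    (hφ : DifferentiableAt ℝ φ (‖x‖ ^ 2)) :
    gradient (fun y : E => φ (‖y‖ ^ 2)) x = (2 * deriv φ (‖x‖ ^ 2)) • x := by
  refine HasGradientAt.gradient (hasGradientAt_iff_hasFDerivAt.mpr ?_)
  refine (hφ.hasDerivAt.comp_hasFDerivAt (f := fun y : E => ‖y‖ ^ 2) x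
    (hasStrictFDerivAt_norm_sq x).hasFDerivAt).congr_fderiv ?_
  ext v
  simp only [smul_apply, coe_innerSL_apply, nsmul_eq_mul, Nat.cast_ofNat, smul_eq_mul, map_smul,
    InnerProductSpace.toDual_apply_apply]
  ring

end RadialCutoff

section RadialExtension

variable {d : ℕ}

theorem sph_ne_zero (η : Sph d) : (η : EuclideanSpace ℝ (Fin d)) ≠ 0 :=
  ne_zero_of_mem_unit_sphere η

theorem radialExt_of_ne (f : Sph d → ℂ) {x : EuclideanSpace ℝ (Fin d)} (hx : x ≠ 0) :
    radialExt f x = f (homeomorphUnitSphereProd (EuclideanSpace ℝ (Fin d)) ⟨x, hx⟩).1 := by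
  rw [radialExt, dif_neg hx]
  congr 1
  ext1
  simp

theorem radialExt_zero (f : Sph d → ℂ) : radialExt f 0 = 0 := dif_pos rfl

theorem radialExt_smul (f : Sph d → ℂ) {c : ℝ} (hc : 0 < c) (x : EuclideanSpace ℝ (Fin d)) :
    radialExt f (c • x) = radialExt f x := by
  by_cases hx : x = 0
  · simp [hx]
  · rw [radialExt, radialExt, dif_neg hx, dif_neg (smul_ne_zero hc.ne' hx)]
    congr 1
    ext1
    simp only [norm_smul, Real.norm_of_nonneg hc.le, smul_smul]
    congr 1
    field_simp

theorem laplacian_radialExt_smul (f : Sph d → ℂ) {c : ℝ} (hc : 0 < c)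
    (x : EuclideanSpace ℝ (Fin d)) :
    (Δ (radialExt f)) x = (c : ℂ) ^ 2 * (Δ (radialExt f)) (c • x) := by
  have hscale : (fun y => radialExt f (c • y)) = radialExt f := funext (radialExt_smul f hc)
  have hfderiv : fderiv ℝ (radialExt f) = fun y => c • fderiv ℝ (radialExt f) (c • y) := by
    ext1 y
    rw [← fderiv_comp_smul, hscale]
  have hfderiv₂ : fderiv ℝ (fderiv ℝ (radialExt f)) x =
      c • c • fderiv ℝ (fderiv ℝ (radialExt f)) (c • x) := by
    conv_lhs => rw [hfderiv]
    rw [← fderiv_comp_smul (f := fderiv ℝ (radialExt f))]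
    exact congrFun
      (fderiv_const_smul_field (𝕜 := ℝ) (f := fun y => fderiv ℝ (radialExt f) (c • y)) c) x
  let b := stdOrthonormalBasis ℝ (EuclideanSpace ℝ (Fin d))
  simp only [laplacian_eq_sum_fderiv_fderiv b, Finset.mul_sum, hfderiv₂, smul_apply,
    Complex.real_smul, ← mul_assoc, sq]

theorem laplacian_radialExt (f : Sph d → ℂ) {x : EuclideanSpace ℝ (Fin d)} (hx : x ≠ 0) :
    (‖x‖ ^ 2 : ℝ) * (Δ (radialExt f)) x = radialExt (sphereLaplacian f) x := by
  have hpos : 0 < ‖x‖ := norm_pos_iff.mpr hx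
  have hne : (‖x‖ : ℂ) ≠ 0 := by exact_mod_cast hpos.ne'
  rw [laplacian_radialExt_smul f (inv_pos.mpr hpos), radialExt, dif_neg hx, sphereLaplacian]
  push_cast
  field_simp

theorem SmoothOnSphere.contDiffAt {f : Sph d → ℂ} (hf : SmoothOnSphere f)
    {x : EuclideanSpace ℝ (Fin d)} (hx : x ≠ 0) : ContDiffAt ℝ ∞ (radialExt f) x :=
  ContDiffOn.contDiffAt hf (isOpen_compl_singleton.mem_nhds hx)

theorem fderiv_radialExt_self {f : Sph d → ℂ} (hf : SmoothOnSphere f)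
    {x : EuclideanSpace ℝ (Fin d)} (hx : x ≠ 0) : fderiv ℝ (radialExt f) x x = 0 := by
  have hray : HasDerivAt (fun c : ℝ => c • x) x 1 := by
    simpa using (hasDerivAt_id (1 : ℝ)).smul_const x
  have hchain : HasDerivAt (radialExt f ∘ fun c : ℝ => c • x) (fderiv ℝ (radialExt f) x x) 1 := by
    refine HasFDerivAt.comp_hasDerivAt 1 ?_ hray
    rw [one_smul]
    exact ((hf.contDiffAt hx).differentiableAt (by simp)).hasFDerivAt
  refine hchain.unique ((hasDerivAt_const 1 (radialExt f x)).congr_of_eventuallyEq ?_)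
  filter_upwards [lt_mem_nhds one_pos] with c hc
  exact radialExt_smul f hc x

theorem radialExt_mul_laplacian_sub (f g : Sph d → ℂ) (x : EuclideanSpace ℝ (Fin d)) :
    ((‖x‖ ^ 2 : ℝ) : ℂ) *
        (radialExt g x * (Δ (radialExt f)) x - radialExt f x * (Δ (radialExt g)) x) =
      radialExt (fun η => g η * sphereLaplacian f η - f η * sphereLaplacian g η) x := by
  by_cases hx : x = 0
  · simp [hx, radialExt_zero]
  · rw [mul_sub, mul_left_comm, laplacian_radialExt f hx, mul_left_comm, laplacian_radialExt g hx]
    simp only [radialExt_of_ne _ hx]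

theorem integral_radial_mul_radialExt (hd : 0 < d) (ρ : ℝ → ℂ) (f : Sph d → ℂ) :
    ∫ x : EuclideanSpace ℝ (Fin d), ρ ‖x‖ * radialExt f x =
      (∫ η, f η ∂(surf d)) * ∫ r : Set.Ioi (0 : ℝ), ρ r ∂(Measure.volumeIoiPow (d - 1)) := by
  have : Nonempty (Fin d) := ⟨⟨0, hd⟩⟩
  let E := EuclideanSpace ℝ (Fin d)
  calc ∫ x : E, ρ ‖x‖ * radialExt f x
      = ∫ x : ({(0)}ᶜ : Set E), ρ ‖x.1‖ * radialExt f x.1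
          ∂((volume : Measure E).comap Subtype.val) := by
        rw [integral_subtype_comap (measurableSet_singleton _).compl
          fun x : E => ρ ‖x‖ * radialExt f x, restrict_compl_singleton]
    _ = ∫ x, f x.1 * ρ x.2 ∂(surf d).prod (.volumeIoiPow (Module.finrank ℝ E - 1)) := by
        rw [← (volume : Measure E).measurePreserving_homeomorphUnitSphereProd.integral_comp
          (Homeomorph.measurableEmbedding _)]
        refine integral_congr_ae (.of_forall fun ⟨x, hx⟩ => ?_)
        simp only
        rw [radialExt_of_ne f hx, mul_comm]
        simp only [homeomorphUnitSphereProd_apply_snd_coe]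
        rfl
    _ = (∫ η, f η ∂(surf d)) * ∫ r : Set.Ioi (0 : ℝ), ρ r ∂(Measure.volumeIoiPow (d - 1)) := by
        rw [finrank_euclideanSpace_fin]
        exact integral_prod_mul f fun r : Set.Ioi (0 : ℝ) => ρ r

theorem integral_annulusBump_norm_sq_pos (hd : 0 < d) :
    0 < ∫ x : EuclideanSpace ℝ (Fin d), annulusBump (‖x‖ ^ 2) := by
  have : Nonempty (Fin d) := ⟨⟨0, hd⟩⟩
  obtain ⟨x, hx⟩ := exists_norm_eq (EuclideanSpace ℝ (Fin d)) (Real.sqrt_nonneg 2)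
  refine Continuous.integral_pos_of_hasCompactSupport_nonneg_nonzero (x := x)
    (contDiff_annulusBump_norm_sq (n := 0)).continuous hasCompactSupport_annulusBump_norm_sq
    (fun _ => annulusBump.nonneg) ?_
  rw [hx, Real.sq_sqrt zero_le_two,
    annulusBump.one_of_mem_closedBall (Metric.mem_closedBall_self annulusBump.rIn_pos.le)]
  exact one_ne_zero

theorem integral_annulusBump_volumeIoiPow_ne_zero (hd : 0 < d) :
    ∫ r : Set.Ioi (0 : ℝ), (annulusBump ((r : ℝ) ^ 2) : ℂ) ∂(Measure.volumeIoiPow (d - 1)) ≠ 0 := by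
  have h := integral_radial_mul_radialExt hd (fun r => (annulusBump (r ^ 2) : ℂ)) fun _ => 1
  have hone (x : EuclideanSpace ℝ (Fin d)) :
      (annulusBump (‖x‖ ^ 2) : ℂ) * radialExt (fun _ => 1) x = (annulusBump (‖x‖ ^ 2) : ℂ) := by
    by_cases hx : x = 0
    · simp [hx, annulusBump_eq_zero]
    · rw [radialExt_of_ne _ hx, mul_one]
  simp only [hone, integral_complex_ofReal] at h
  rw [integral_complex_ofReal]
  refine right_ne_zero_of_mul (a := ∫ _ : Sph d, (1 : ℂ) ∂(surf d)) (h.symm.trans_ne ?_)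
  exact_mod_cast (integral_annulusBump_norm_sq_pos hd).ne'

theorem integral_mul_sphereLaplacian_sub_eq_zero {f g : Sph d → ℂ} (hf : SmoothOnSphere f)
    (hg : SmoothOnSphere g) :
    ∫ η, (g η * sphereLaplacian f η - f η * sphereLaplacian g η) ∂(surf d) = 0 := by
  rcases d.eq_zero_or_pos with rfl | hd
  · exact integral_of_isEmpty
  let φ : ℝ → ℝ := fun s => s * annulusBump s
  have hφ : ContDiff ℝ 1 φ := contDiff_id.mul annulusBump.contDiff
  have hsupp {x : EuclideanSpace ℝ (Fin d)} (hx : x ∈ tsupport fun y => φ (‖y‖ ^ 2)) : x ≠ 0 :=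
    ne_zero_of_mem_tsupport_mul_annulusBump (φ := fun y => ‖y‖ ^ 2) hx
  have hcont {h : Sph d → ℂ} (hh : SmoothOnSphere h) (x)
      (hx : x ∈ tsupport fun y : EuclideanSpace ℝ (Fin d) => φ (‖y‖ ^ 2)) :
      ContDiffAt ℝ 2 (radialExt h) x := (hh.contDiffAt (hsupp hx)).of_le (by norm_cast)
  have hgrad {h : Sph d → ℂ} (hh : SmoothOnSphere h) (x)
      (hx : x ∈ tsupport fun y : EuclideanSpace ℝ (Fin d) => φ (‖y‖ ^ 2)) :
      fderiv ℝ (radialExt h) x (gradient (fun y => φ (‖y‖ ^ 2)) x) = 0 := by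
    rw [gradient_comp_norm_sq (hφ.differentiable one_ne_zero _), map_smul,
      fderiv_radialExt_self hh (hsupp hx), smul_zero]
  have hgreen := integral_mul_laplacian_sub_mul_laplacian_eq_zero volume
    (hφ.comp (contDiff_norm_sq ℝ)) hasCompactSupport_annulusBump_norm_sq.mul_left
    (hcont hf) (hcont hg) (hgrad hf) (hgrad hg)
  have hpolar := integral_radial_mul_radialExt hd (fun r => (annulusBump (r ^ 2) : ℂ))
    fun η => g η * sphereLaplacian f η - f η * sphereLaplacian g η
  simp only [← radialExt_mul_laplacian_sub] at hpolar
  simp only [φ, Function.comp_apply, Complex.ofReal_mul, mul_assoc] at hgreen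
  refine (mul_eq_zero.mp (hpolar.symm.trans ?_)).resolve_right
    (integral_annulusBump_volumeIoiPow_ne_zero hd)
  simpa only [mul_left_comm] using hgreen

end RadialExtension

section Spectral

variable {d : ℕ}

theorem radialExt_conj (f : Sph d → ℂ) :
    radialExt (fun η => starRingEnd ℂ (f η)) = Complex.conjCLE ∘ radialExt f := by
  ext x
  by_cases hx : x = 0
  · simp [hx, radialExt_zero]
  · simp [radialExt_of_ne _ hx]

theorem SmoothOnSphere.conj {f : Sph d → ℂ} (hf : SmoothOnSphere f) :
    SmoothOnSphere fun η => starRingEnd ℂ (f η) := by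
  rw [SmoothOnSphere, radialExt_conj]
  exact Complex.conjCLE.contDiff.comp_contDiffOn hf

theorem sphereLaplacian_conj (f : Sph d → ℂ) (η : Sph d) :
    sphereLaplacian (fun ζ => starRingEnd ℂ (f ζ)) η = starRingEnd ℂ (sphereLaplacian f η) := by
  rw [sphereLaplacian, radialExt_conj]
  exact congrFun (InnerProductSpace.laplacian_CLE_comp_left (l := Complex.conjCLE)) _

theorem integral_mul_eq_zero_of_sphereLaplacian_eq {f g : Sph d → ℂ} (hf : SmoothOnSphere f)
    (hg : SmoothOnSphere g) {lam mu : ℂ} (hne : lam ≠ mu)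
    (hLf : ∀ η, sphereLaplacian f η = lam * f η) (hLg : ∀ η, sphereLaplacian g η = mu * g η) :
    ∫ η, f η * g η ∂(surf d) = 0 := by
  have hgreen := integral_mul_sphereLaplacian_sub_eq_zero hf hg
  have hdiff (η : Sph d) : g η * sphereLaplacian f η - f η * sphereLaplacian g η =
      (lam - mu) * (f η * g η) := by
    rw [hLf, hLg]
    ring
  simp only [hdiff, integral_const_mul] at hgreen
  exact (mul_eq_zero.mp hgreen).resolve_left (sub_ne_zero.mpr hne)

theorem isOrtho_eigenspace {lam mu : ℝ} (hne : lam ≠ mu) :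
    eigenspace d lam ⟂ eigenspace d mu := by
  rw [Submodule.isOrtho_iff_le, eigenspace, eigenspace, Submodule.orthogonal_closure]
  refine Submodule.topologicalClosure_minimal _ (Submodule.isOrtho_iff_le.mp ?_)
    (Submodule.isClosed_orthogonal _)
  refine Submodule.isOrtho_span.mpr ?_
  rintro F ⟨f, hf, hLf, hFf⟩ G ⟨g, hg, hLg, hGg⟩
  rw [L2.inner_def, ← integral_mul_eq_zero_of_sphereLaplacian_eq hg hf.conj
    (lam := -mu) (mu := -lam) (by simpa using hne.symm) hLg
    fun η => by simp [sphereLaplacian_conj, hLf]]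
  refine integral_congr_ae ?_
  filter_upwards [hFf, hGg] with η hF hG
  rw [hF, hG, RCLike.inner_apply]

theorem starProjection_eigenspace {mu : ℝ} {ψ : Lp ℂ 2 (surf d)} (hψ : ψ ∈ eigenspace d mu)
    (lam : ℝ) : (eigenspace d lam).starProjection ψ = if lam = mu then ψ else 0 := by
  split_ifs with h
  · subst h
    exact Submodule.starProjection_eq_self_iff.mpr hψ
  · exact (Submodule.starProjection_apply_eq_zero_iff _).mpr
      (Submodule.isOrtho_iff_le.mp (isOrtho_eigenspace (Ne.symm h)) hψ)

theorem schrodinger_sum_of_mem_eigenspace {ι : Type*} (s : Finset ι) {lam : ι → ℝ}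
    {ψ : ι → Lp ℂ 2 (surf d)} (hψ : ∀ i, ψ i ∈ eigenspace d (lam i)) (t : ℝ) :
    schrodinger d t (∑ i ∈ s, ψ i) =
      ∑ i ∈ s, Complex.exp (-(Complex.I * t * lam i)) • ψ i := by
  have hterm (mu : ℝ) : Complex.exp (-(Complex.I * t * mu)) •
      (eigenspace d mu).starProjection (∑ i ∈ s, ψ i) =
      ∑ i ∈ s, if mu = lam i then Complex.exp (-(Complex.I * t * lam i)) • ψ i else 0 := by
    rw [map_sum, Finset.smul_sum]
    refine Finset.sum_congr rfl fun i _ => ?_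
    rw [starProjection_eigenspace (hψ i)]
    split_ifs with h
    · rw [h]
    · rw [smul_zero]
  simp only [schrodinger, hterm]
  exact (hasSum_sum fun i _ => hasSum_ite_eq (lam i) _).tsum_eq

end Spectral

section LaplacianAlongLines

theorem iteratedFDeriv_two_apply_self {E F : Type*} [NormedAddCommGroup E] [NormedSpace ℝ E]
    [NormedAddCommGroup F] [NormedSpace ℝ F] {f : E → F} {x : E} (hf : ContDiffAt ℝ 2 f x)
    (v : E) : iteratedFDeriv ℝ 2 f x (fun _ => v) =
      iteratedDeriv 2 (fun s : ℝ => f (x + s • v)) 0 := by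
  have hline (s : ℝ) : HasDerivAt (fun s : ℝ => x + s • v) v s := by
    simpa using ((hasDerivAt_id s).smul_const v).const_add x
  have hline₂ : iteratedDeriv 2 (fun s : ℝ => x + s • v) 0 = 0 := by
    rw [iteratedDeriv_succ, iteratedDeriv_one, funext fun s => (hline s).deriv, deriv_const]
  have h := iteratedDeriv_vcomp_two (x := (0 : ℝ)) (f := fun s : ℝ => x + s • v) (g := f)
    (by simpa using hf) (by fun_prop)
  rw [hline₂, (hline 0).deriv, map_zero, add_zero, zero_smul, add_zero] at h
  exact h.symm

theorem laplacian_eq_sum_iteratedDeriv {E F : Type*} [NormedAddCommGroup E]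
    [InnerProductSpace ℝ E] [FiniteDimensional ℝ E] [NormedAddCommGroup F] [NormedSpace ℝ F]
    {ι : Type*} [Fintype ι] (b : OrthonormalBasis ι ℝ E) {f : E → F} {x : E}
    (hf : ContDiffAt ℝ 2 f x) :
    (Δ f) x = ∑ i, iteratedDeriv 2 (fun s : ℝ => f (x + s • b i)) 0 := by
  rw [InnerProductSpace.laplacian_eq_iteratedFDeriv_orthonormalBasis f b]
  refine Finset.sum_congr rfl fun i _ => ?_
  rw [← iteratedFDeriv_two_apply_self hf]
  congr
  ext j
  fin_cases j <;> rfl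

end LaplacianAlongLines

section NormalizedLine

/-- The function `s ↦ ⟪ξ, x⟫ / ‖x‖` along the line `x = η + s v` through a point `η` of the unit
sphere in a unit direction `v`, where `t = ⟪ξ, η⟫`, `a = ⟪ξ, v⟫` and `b = ⟪η, v⟫`. -/
def normalizedLine (t a b s : ℝ) : ℝ := (t + s * a) * (1 + 2 * b * s + s ^ 2) ^ (-(1 / 2) : ℝ)

variable (t a b : ℝ)

theorem normalizedLine_zero : normalizedLine t a b 0 = t := by simp [normalizedLine]

theorem hasDerivAt_normSq_line_rpow {s : ℝ} (hs : 0 < 1 + 2 * b * s + s ^ 2) (p : ℝ) :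
    HasDerivAt (fun s : ℝ => (1 + 2 * b * s + s ^ 2) ^ p)
      (2 * (b + s) * p * (1 + 2 * b * s + s ^ 2) ^ (p - 1)) s := by
  have hbase : HasDerivAt (fun s : ℝ => 1 + 2 * b * s + s ^ 2) (2 * (b + s)) s := by
    refine ((((hasDerivAt_id' s).const_mul (2 * b)).const_add 1).fun_add
      (hasDerivAt_pow 2 s)).congr_deriv ?_
    ring
  exact hbase.rpow_const (.inl hs.ne')

theorem contDiffAt_normalizedLine {n : WithTop ℕ∞} : ContDiffAt ℝ n (normalizedLine t a b) 0 := by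
  have hbase : ContDiffAt ℝ n (fun s : ℝ => 1 + 2 * b * s + s ^ 2) 0 := by fun_prop
  exact (by fun_prop : ContDiffAt ℝ n (fun s : ℝ => t + s * a) 0).mul
    (hbase.rpow_const_of_ne (by simp))

theorem hasDerivAt_normalizedLine {s : ℝ} (hs : 0 < 1 + 2 * b * s + s ^ 2) :
    HasDerivAt (normalizedLine t a b) (a * (1 + 2 * b * s + s ^ 2) ^ (-(1 / 2) : ℝ) -
      (t + s * a) * (b + s) * (1 + 2 * b * s + s ^ 2) ^ (-(3 / 2) : ℝ)) s := by
  have hline : HasDerivAt (fun s : ℝ => t + s * a) a s := by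
    simpa using ((hasDerivAt_id s).mul_const a).const_add t
  refine (hline.fun_mul (hasDerivAt_normSq_line_rpow b hs (-(1 / 2)))).congr_deriv ?_
  rw [show (-(1 / 2) - 1 : ℝ) = -(3 / 2) by norm_num]
  ring

theorem deriv_normalizedLine_zero : deriv (normalizedLine t a b) 0 = a - t * b := by
  simpa using (hasDerivAt_normalizedLine t a b (s := 0) (by simp)).deriv

theorem iteratedDeriv_two_normalizedLine_zero :
    iteratedDeriv 2 (normalizedLine t a b) 0 = -2 * (a * b) - t + 3 * t * b ^ 2 := by
  have hpos : ∀ᶠ s : ℝ in 𝓝 0, 0 < 1 + 2 * b * s + s ^ 2 :=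
    (show ContinuousAt (fun s : ℝ => 1 + 2 * b * s + s ^ 2) 0 by fun_prop).eventually_const_lt
      (by simp)
  have hderiv := hpos.mono fun s hs => (hasDerivAt_normalizedLine t a b hs).deriv
  rw [iteratedDeriv_succ, iteratedDeriv_one, EventuallyEq.deriv_eq hderiv]
  have hline : HasDerivAt (fun s : ℝ => t + s * a) a 0 := by
    simpa using ((hasDerivAt_id (0 : ℝ)).mul_const a).const_add t
  have hrpow := hasDerivAt_normSq_line_rpow b hpos.self_of_nhds
  refine (((hrpow (-(1 / 2))).const_mul a).fun_sub ((hline.fun_mul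
    ((hasDerivAt_id' (0 : ℝ)).const_add b)).fun_mul (hrpow (-(3 / 2))))).deriv.trans ?_
  simp only [add_zero, one_div, mul_neg, mul_zero, ne_eq, OfNat.ofNat_ne_zero, not_false_eq_true,
    zero_pow, Real.one_rpow, mul_one, zero_mul, neg_mul]
  ring

theorem iteratedDeriv_two_eval_normalizedLine_zero (q : Polynomial ℝ) :
    iteratedDeriv 2 (fun s => q.eval (normalizedLine t a b s)) 0 =
      q.derivative.derivative.eval t * (a - t * b) ^ 2 +
        q.derivative.eval t * (-2 * (a * b) - t + 3 * t * b ^ 2) := by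
  have hq : ContDiff ℝ 2 fun t => q.eval t := by
    simpa using q.contDiff_aeval (R := ℝ) (𝕜 := ℝ) 2
  refine (iteratedDeriv_comp_two hq.contDiffAt (contDiffAt_normalizedLine t a b)).trans ?_
  have hderiv (q : Polynomial ℝ) : deriv (fun t => q.eval t) = fun t => q.derivative.eval t :=
    funext fun _ => q.deriv
  rw [iteratedDeriv_two_normalizedLine_zero, deriv_normalizedLine_zero, normalizedLine_zero,
    iteratedDeriv_succ, iteratedDeriv_one, hderiv, hderiv]

end NormalizedLine

section ZonalFunctions

variable {d : ℕ}

/-- The function `x ↦ ⟪ξ, x⟫ / ‖x‖`, the extension of `dot ξ` that is constant on rays. -/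
def rayDot (ξ : Sph d) (x : EuclideanSpace ℝ (Fin d)) : ℝ :=
  inner ℝ (ξ : EuclideanSpace ℝ (Fin d)) x * ‖x‖⁻¹

/-- The complex-valued zonal function `η ↦ q (ξ · η)` with pole `ξ` and profile `q`. -/
def zonalFun (q : Polynomial ℝ) (ξ η : Sph d) : ℂ := ((q.eval (dot ξ η) : ℝ) : ℂ)

theorem radialExt_zonalFun (q : Polynomial ℝ) (ξ : Sph d) {x : EuclideanSpace ℝ (Fin d)}
    (hx : x ≠ 0) : radialExt (zonalFun q ξ) x = ((q.eval (rayDot ξ x) : ℝ) : ℂ) := by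
  rw [radialExt, dif_neg hx, zonalFun, dot, rayDot]
  simp only [inner_smul_right]
  rw [mul_comm]

theorem contDiffAt_eval_rayDot (q : Polynomial ℝ) (ξ : Sph d) {x : EuclideanSpace ℝ (Fin d)}
    (hx : x ≠ 0) {n : ℕ∞} : ContDiffAt ℝ n (fun y => q.eval (rayDot ξ y)) x := by
  have hq : ContDiff ℝ n fun t => q.eval t := by
    simpa using q.contDiff_aeval (R := ℝ) (𝕜 := ℝ) n
  exact hq.contDiffAt.comp x ((contDiffAt_const.inner ℝ contDiffAt_id).mul
    ((contDiffAt_norm ℝ hx).inv (norm_ne_zero_iff.mpr hx)))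

theorem smoothOnSphere_zonalFun (q : Polynomial ℝ) (ξ : Sph d) :
    SmoothOnSphere (zonalFun q ξ) := by
  refine ContDiffOn.congr (fun x hx => ?_) fun x hx => radialExt_zonalFun q ξ hx
  exact (Complex.ofRealCLM.contDiff.contDiffAt.comp x
    (contDiffAt_eval_rayDot q ξ hx)).contDiffWithinAt

theorem rayDot_add_smul (ξ η : Sph d) {v : EuclideanSpace ℝ (Fin d)} (hv : ‖v‖ = 1) (s : ℝ) :
    rayDot ξ (η + s • v) = normalizedLine (dot ξ η)
      (inner ℝ (ξ : EuclideanSpace ℝ (Fin d)) v) (inner ℝ v (η : EuclideanSpace ℝ (Fin d))) s := by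
  have hnorm : ‖(η : EuclideanSpace ℝ (Fin d)) + s • v‖ ^ 2 =
      1 + 2 * inner ℝ v (η : EuclideanSpace ℝ (Fin d)) * s + s ^ 2 := by
    rw [norm_add_sq_real, norm_eq_of_mem_sphere, norm_smul, hv, inner_smul_right,
      real_inner_comm, mul_one, Real.norm_eq_abs, sq_abs]
    ring
  rw [rayDot, normalizedLine, ← hnorm, ← Real.rpow_natCast, ← Real.rpow_mul (norm_nonneg _),
    inner_add_right, inner_smul_right, dot]
  norm_num [Real.rpow_neg_one]

theorem laplacian_eval_rayDot (q : Polynomial ℝ) (ξ η : Sph d) :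
    (Δ fun x => q.eval (rayDot ξ x)) η =
      (1 - dot ξ η ^ 2) * q.derivative.derivative.eval (dot ξ η) -
        (d - 1) * dot ξ η * q.derivative.eval (dot ξ η) := by
  let B := EuclideanSpace.basisFun (Fin d) ℝ
  have hsum_left : ∑ i, inner ℝ (ξ : EuclideanSpace ℝ (Fin d)) (B i) ^ 2 = 1 := by
    rw [B.sum_sq_inner_left, norm_eq_of_mem_sphere, one_pow]
  have hsum_right : ∑ i, inner ℝ (B i) (η : EuclideanSpace ℝ (Fin d)) ^ 2 = 1 := by
    rw [B.sum_sq_inner_right, norm_eq_of_mem_sphere, one_pow]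
  have hsum_mul : ∑ i, inner ℝ (ξ : EuclideanSpace ℝ (Fin d)) (B i) *
      inner ℝ (B i) (η : EuclideanSpace ℝ (Fin d)) = dot ξ η := B.sum_inner_mul_inner _ _
  rw [laplacian_eq_sum_iteratedDeriv B (contDiffAt_eval_rayDot q ξ (sph_ne_zero η) (n := 2))]
  simp only [rayDot_add_smul ξ η (B.norm_eq_one _), iteratedDeriv_two_eval_normalizedLine_zero]
  have hexpand (Q₂ Q₁ t a b : ℝ) :
      Q₂ * (a - t * b) ^ 2 + Q₁ * (-2 * (a * b) - t + 3 * t * b ^ 2) =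
        Q₂ * a ^ 2 + (-2 * t * Q₂ - 2 * Q₁) * (a * b) + (Q₂ * t ^ 2 + 3 * t * Q₁) * b ^ 2 -
          Q₁ * t := by
    ring
  simp only [hexpand, Finset.sum_sub_distrib, Finset.sum_add_distrib, ← Finset.mul_sum, hsum_left,
    hsum_right, hsum_mul, Finset.sum_const, Finset.card_univ, Fintype.card_fin, nsmul_eq_mul]
  ring

theorem sphereLaplacian_zonalFun (q : Polynomial ℝ) (ξ η : Sph d) :
    sphereLaplacian (zonalFun q ξ) η =
      (((1 - dot ξ η ^ 2) * q.derivative.derivative.eval (dot ξ η) -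
        (d - 1) * dot ξ η * q.derivative.eval (dot ξ η) : ℝ) : ℂ) := by
  have hext : radialExt (zonalFun q ξ) =ᶠ[𝓝 (η : EuclideanSpace ℝ (Fin d))]
      Complex.ofRealCLM ∘ fun x => q.eval (rayDot ξ x) := by
    filter_upwards [isOpen_compl_singleton.mem_nhds (sph_ne_zero η)] with x hx
    exact radialExt_zonalFun q ξ hx
  rw [sphereLaplacian, (InnerProductSpace.laplacian_congr_nhds hext).self_of_nhds,
    (contDiffAt_eval_rayDot q ξ (sph_ne_zero η) (n := 2)).laplacian_CLM_comp_left,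
    Function.comp_apply, laplacian_eval_rayDot, Complex.ofRealCLM_apply]

end ZonalFunctions

section JacobiRecurrence

/-- A discrete energy for the three-term recurrence
`t * y (k + 1) = a (k + 1) * y (k + 2) + a k * y k`. For constant `a` it is conserved, and for
`|t| < 2 * a` it is a positive definite quadratic form in `(y k, y (k + 1))`. -/
def jacobiEnergy (a y : ℕ → ℝ) (t : ℝ) (k : ℕ) : ℝ :=
  a k ^ 2 * (y (k + 1) ^ 2 + y k ^ 2) - t * a k * y (k + 1) * y k

variable {a y : ℕ → ℝ} {t : ℝ}

theorem jacobiEnergy_succ {k : ℕ} (h : t * y (k + 1) = a (k + 1) * y (k + 2) + a k * y k) :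
    jacobiEnergy a y t (k + 1) =
      jacobiEnergy a y t k + (a (k + 1) ^ 2 - a k ^ 2) * y (k + 1) ^ 2 := by
  unfold jacobiEnergy
  linear_combination (a k * y k - a (k + 1) * y (k + 2)) * h

theorem le_jacobiEnergy {b : ℝ} {k : ℕ} (hb : |t| / 2 ≤ b) (hbk : b ≤ a k) :
    b * (b - |t| / 2) * (y (k + 1) ^ 2 + y k ^ 2) ≤ jacobiEnergy a y t k := by
  have ht := abs_nonneg t
  have hcross : t * (y (k + 1) * y k) ≤ |t| * ((y (k + 1) ^ 2 + y k ^ 2) / 2) :=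
    calc t * (y (k + 1) * y k) ≤ |t| * |y (k + 1) * y k| := (le_abs_self _).trans (abs_mul _ _).le
      _ ≤ |t| * ((y (k + 1) ^ 2 + y k ^ 2) / 2) := by
        gcongr
        rw [abs_le]
        constructor <;> nlinarith [sq_nonneg (y (k + 1) - y k), sq_nonneg (y (k + 1) + y k)]
  calc b * (b - |t| / 2) * (y (k + 1) ^ 2 + y k ^ 2)
      ≤ a k * (a k - |t| / 2) * (y (k + 1) ^ 2 + y k ^ 2) := by
        gcongr
        linarith
    _ ≤ jacobiEnergy a y t k := by
        unfold jacobiEnergy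
        linarith [mul_le_mul_of_nonneg_left hcross (by linarith : 0 ≤ a k)]

theorem bddAbove_range_sq_of_jacobi {L : ℝ}
    (hrec : ∀ k, t * y (k + 1) = a (k + 1) * y (k + 2) + a k * y k)
    (ha : Tendsto a atTop (𝓝 L)) (hsum : Summable fun k => |a (k + 1) ^ 2 - a k ^ 2|)
    (ht : |t| / 2 < L) : BddAbove (Set.range fun k => y k ^ 2) := by
  obtain ⟨b, hb, hbL⟩ := exists_between ht
  obtain ⟨n₀, hn₀⟩ := eventually_atTop.mp (ha.eventually_const_le hbL)
  set κ := b * (b - |t| / 2)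
  have hκ : 0 < κ := mul_pos (by linarith [abs_nonneg t]) (by linarith)
  set E := jacobiEnergy a y t
  have hE {k : ℕ} (hk : n₀ ≤ k) : κ * (y (k + 1) ^ 2 + y k ^ 2) ≤ E k :=
    le_jacobiEnergy hb.le (hn₀ k hk)
  set c : ℕ → ℝ := fun k => κ⁻¹ * |a (k + 1) ^ 2 - a k ^ 2|
  have hc (k : ℕ) : 0 ≤ c k := by positivity
  have hstep (k : ℕ) (hk : k ≥ n₀) : E (k + 1) ≤ (1 + c k) * E k + 0 :=
    calc E (k + 1) = E k + (a (k + 1) ^ 2 - a k ^ 2) * y (k + 1) ^ 2 := jacobiEnergy_succ (hrec k)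
      _ ≤ E k + |a (k + 1) ^ 2 - a k ^ 2| * (y (k + 1) ^ 2 + y k ^ 2) := by
        gcongr
        exacts [le_abs_self _, le_add_of_nonneg_right (sq_nonneg _)]
      _ = E k + c k * (κ * (y (k + 1) ^ 2 + y k ^ 2)) := by
        simp only [c]
        field_simp
      _ ≤ E k + c k * E k := by
        gcongr
        exact hE hk
      _ = (1 + c k) * E k + 0 := by ring
  have hE₀ : 0 ≤ E n₀ := le_trans (by positivity) (hE le_rfl)
  have hbound {k : ℕ} (hk : n₀ ≤ k) : y k ^ 2 ≤ κ⁻¹ * (E n₀ * Real.exp (∑' i, c i)) := by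
    have hgronwall := discrete_gronwall hE₀ hstep (fun k _ => hc k) (fun _ _ => le_rfl) hk
    rw [Finset.sum_const_zero, add_zero] at hgronwall
    rw [le_inv_mul_iff₀ hκ]
    calc κ * y k ^ 2 ≤ κ * (y (k + 1) ^ 2 + y k ^ 2) := by
          gcongr
          exact le_add_of_nonneg_left (sq_nonneg _)
      _ ≤ E k := hE hk
      _ ≤ E n₀ * Real.exp (∑ i ∈ Finset.Ico n₀ k, c i) := hgronwall
      _ ≤ E n₀ * Real.exp (∑' i, c i) := by
          gcongr
          exact (hsum.mul_left κ⁻¹).sum_le_tsum _ fun i _ => hc i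
  exact (isBoundedUnder_of_eventually_le
    (eventually_atTop.mpr ⟨n₀, fun k => hbound⟩)).bddAbove_range

end JacobiRecurrence

section SphereGeometry

variable {d : ℕ}

theorem continuous_dot_right (ξ : Sph d) : Continuous fun η : Sph d => dot ξ η := by
  unfold dot
  fun_prop

theorem dot_self (ξ : Sph d) : dot ξ ξ = 1 := by
  rw [dot, real_inner_self_eq_norm_sq, norm_eq_of_mem_sphere ξ, one_pow]

theorem dot_neg (ξ η : Sph d) : dot ξ (-η) = -dot ξ η := by
  simp [dot]

theorem abs_dot_le_one (ξ η : Sph d) : |dot ξ η| ≤ 1 := by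
  have := abs_real_inner_le_norm (ξ : EuclideanSpace ℝ (Fin d)) η
  rwa [norm_eq_of_mem_sphere ξ, norm_eq_of_mem_sphere η, one_mul] at this

theorem dist_sq_eq (ξ η : Sph d) : dist ξ η ^ 2 = 2 - 2 * dot ξ η := by
  rw [Subtype.dist_eq, dist_eq_norm, norm_sub_sq_real, norm_eq_of_mem_sphere ξ,
    norm_eq_of_mem_sphere η, dot]
  ring

theorem dot_lt_one_of_ne {ξ η : Sph d} (h : η ≠ ξ) : dot ξ η < 1 := by
  have hdist := pow_pos (dist_pos.mpr h.symm) 2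
  rw [dist_sq_eq] at hdist
  linarith

theorem abs_dot_lt_one_of_ne {ξ η : Sph d} (h : η ≠ ξ) (h' : η ≠ -ξ) : |dot ξ η| < 1 := by
  have hneg := dot_lt_one_of_ne (ξ := ξ) (η := -η) fun he => h' (neg_eq_iff_eq_neg.mp he)
  rw [dot_neg] at hneg
  exact abs_lt.mpr ⟨by linarith, dot_lt_one_of_ne h⟩

theorem integrable_of_continuous {F : Type*} [NormedAddCommGroup F] {f : Sph d → F}
    (hf : Continuous f) : Integrable f (surf d) :=
  hf.integrable_of_hasCompactSupport (HasCompactSupport.of_compactSpace f)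

theorem surf_real_univ_pos (hd : 0 < d) : 0 < (surf d).real Set.univ := by
  have : Nonempty (Fin d) := ⟨⟨0, hd⟩⟩
  have : NeZero (surf d) := ⟨Measure.toSphere_ne_zero _⟩
  exact measureReal_univ_pos

end SphereGeometry

section OrthonormalZonalPolynomials

open Polynomial

variable {d : ℕ}

theorem continuous_eval_dot (p : ℝ[X]) (ξ : Sph d) :
    Continuous fun η : Sph d => p.eval (dot ξ η) :=
  p.continuous.comp (continuous_dot_right ξ)

/-- The mean over the sphere of the zonal function `η ↦ p (ξ · η)`, as a linear functional of the
polynomial `p`. -/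
def zonalMean (ξ : Sph d) : ℝ[X] →ₗ[ℝ] ℝ where
  toFun p := ⨍ η, p.eval (dot ξ η) ∂(surf d)
  map_add' p q := by
    simp only [eval_add]
    exact integral_add (integrable_of_continuous (continuous_eval_dot p ξ)).to_average
      (integrable_of_continuous (continuous_eval_dot q ξ)).to_average
  map_smul' c p := by
    simp only [eval_smul, smul_eq_mul, RingHom.id_apply]
    exact integral_const_mul _ _

theorem zonalMean_apply (ξ : Sph d) (p : ℝ[X]) :
    zonalMean ξ p = ⨍ η, p.eval (dot ξ η) ∂(surf d) := rfl

theorem zonalMean_C_mul (ξ : Sph d) (c : ℝ) (p : ℝ[X]) :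
    zonalMean ξ (C c * p) = c * zonalMean ξ p := by
  rw [← smul_eq_C_mul, map_smul, smul_eq_mul]

/-- The zonal polynomial of degree `k`, normalized to have norm `1` with respect to the uniform
probability measure of the sphere. -/
def zonalOrtho (d k : ℕ) : ℝ[X] := C (√(harmDim d k))⁻¹ * zonalPoly d k

/-- The off-diagonal coefficients of the (symmetric, tridiagonal) matrix of the multiplication by
`X` in the basis `zonalOrtho d k`. -/
def zonalJacobi (d k : ℕ) : ℝ := √(zonalUp d k * zonalDown d k)

theorem zonalPoly_eval_eq (hd : 3 ≤ d) (k : ℕ) (t : ℝ) :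
    (zonalPoly d k).eval t = √(harmDim d k) * (zonalOrtho d k).eval t := by
  have := Real.sqrt_pos.mpr (harmDim_pos hd k)
  rw [zonalOrtho, eval_C_mul]
  field_simp

theorem zonalOrtho_zero (hd : 3 ≤ d) : zonalOrtho d 0 = 1 := by
  simp [zonalOrtho, zonalPoly_zero hd, harmDim_zero hd]

theorem zonalJacobi_sq (hd : 3 ≤ d) (k : ℕ) :
    zonalJacobi d k ^ 2 = zonalUp d k * zonalDown d k :=
  Real.sq_sqrt (mul_pos (zonalUp_pos hd k) (zonalDown_pos hd k)).le

theorem zonalJacobi_pos (hd : 3 ≤ d) (k : ℕ) : 0 < zonalJacobi d k :=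
  Real.sqrt_pos.mpr (mul_pos (zonalUp_pos hd k) (zonalDown_pos hd k))

theorem zonalJacobi_mul_sqrt_harmDim (hd : 3 ≤ d) (k : ℕ) :
    zonalJacobi d k * √(harmDim d k) = zonalUp d k * √(harmDim d (k + 1)) := by
  have hup := (zonalUp_pos hd k).le
  rw [zonalJacobi, ← Real.sqrt_mul (mul_nonneg hup (zonalDown_pos hd k).le), mul_assoc,
    ← zonalUp_mul_harmDim_succ hd k, ← mul_assoc, Real.sqrt_mul (mul_nonneg hup hup),
    Real.sqrt_mul_self hup]

theorem zonalJacobi_mul_sqrt_harmDim_succ (hd : 3 ≤ d) (k : ℕ) :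
    zonalJacobi d k * √(harmDim d (k + 1)) = zonalDown d k * √(harmDim d k) := by
  have hdown := (zonalDown_pos hd k).le
  rw [zonalJacobi, mul_comm (zonalUp d k),
    ← Real.sqrt_mul (mul_nonneg hdown (zonalUp_pos hd k).le), mul_assoc,
    zonalUp_mul_harmDim_succ hd k, ← mul_assoc, Real.sqrt_mul (mul_nonneg hdown hdown),
    Real.sqrt_mul_self hdown]

theorem X_mul_zonalOrtho_zero (hd : 3 ≤ d) :
    X * zonalOrtho d 0 = C (zonalJacobi d 0) * zonalOrtho d 1 := by
  refine funext fun t => mul_left_cancel₀ (Real.sqrt_pos.mpr (harmDim_pos hd 0)).ne' ?_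
  have hrec := congrArg (eval t) (X_mul_zonalPoly_zero hd)
  simp only [eval_mul, eval_C, eval_X, zonalPoly_eval_eq hd] at hrec ⊢
  linear_combination hrec - (zonalOrtho d 1).eval t * zonalJacobi_mul_sqrt_harmDim hd 0

theorem X_mul_zonalOrtho_succ (hd : 3 ≤ d) (k : ℕ) :
    X * zonalOrtho d (k + 1) =
      C (zonalJacobi d (k + 1)) * zonalOrtho d (k + 2) + C (zonalJacobi d k) * zonalOrtho d k := by
  refine funext fun t => mul_left_cancel₀ (Real.sqrt_pos.mpr (harmDim_pos hd (k + 1))).ne' ?_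
  have hrec := congrArg (eval t) (X_mul_zonalPoly_succ hd k)
  simp only [eval_mul, eval_add, eval_C, eval_X, zonalPoly_eval_eq hd] at hrec ⊢
  linear_combination hrec
    - (zonalOrtho d (k + 2)).eval t * zonalJacobi_mul_sqrt_harmDim hd (k + 1)
    - (zonalOrtho d k).eval t * zonalJacobi_mul_sqrt_harmDim_succ hd k

theorem zonalOrtho_eval_sq_of_sq_eq_one (hd : 3 ≤ d) {t : ℝ} (ht : t ^ 2 = 1) (k : ℕ) :
    (zonalOrtho d k).eval t ^ 2 = harmDim d k := by
  have hN := harmDim_pos hd k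
  rw [zonalOrtho, eval_C_mul, zonalPoly_eval_of_sq_eq_one hd ht, mul_pow, inv_pow,
    Real.sq_sqrt hN.le, mul_pow, ← pow_mul, mul_comm k, pow_mul, ht, one_pow, one_mul]
  field_simp

/-- The eigenvalue of `-Δ` on spherical harmonics of degree `k`. -/
def sphereEigenvalue (d k : ℕ) : ℝ := k * (k + d - 2)

theorem sphereEigenvalue_injective (hd : 3 ≤ d) : Function.Injective (sphereEigenvalue d) := by
  have : (3 : ℝ) ≤ d := mod_cast hd
  refine (strictMono_nat_of_lt_succ fun k => ?_).injective
  have : (0 : ℝ) ≤ k := k.cast_nonneg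
  simp only [sphereEigenvalue]
  push_cast
  nlinarith

theorem sphereLaplacian_zonalOrtho (k : ℕ) (ξ η : Sph d) :
    sphereLaplacian (zonalFun (zonalOrtho d k) ξ) η =
      -(sphereEigenvalue d k : ℂ) * zonalFun (zonalOrtho d k) ξ η := by
  have hode := congrArg (eval (dot ξ η)) (zonalPoly_ode (d := d) k)
  simp only [eval_mul, eval_sub, eval_add, eval_neg, eval_pow, eval_one, eval_X, eval_natCast,
    eval_ofNat] at hode
  rw [sphereLaplacian_zonalFun, zonalFun, sphereEigenvalue, ← Complex.ofReal_neg,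
    ← Complex.ofReal_mul, Complex.ofReal_inj]
  simp only [zonalOrtho, derivative_C_mul, eval_C_mul]
  linear_combination (√(harmDim d k))⁻¹ * hode

theorem zonalMean_mul_of_ne (hd : 3 ≤ d) (ξ : Sph d) {j k : ℕ} (hjk : j ≠ k) :
    zonalMean ξ (zonalOrtho d j * zonalOrtho d k) = 0 := by
  have hne : -(sphereEigenvalue d j : ℂ) ≠ -(sphereEigenvalue d k : ℂ) :=
    neg_injective.ne (Complex.ofReal_injective.ne ((sphereEigenvalue_injective hd).ne hjk))
  have hint := integral_mul_eq_zero_of_sphereLaplacian_eq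
    (smoothOnSphere_zonalFun (zonalOrtho d j) ξ) (smoothOnSphere_zonalFun (zonalOrtho d k) ξ)
    hne (sphereLaplacian_zonalOrtho j ξ) (sphereLaplacian_zonalOrtho k ξ)
  simp only [zonalFun, ← Complex.ofReal_mul, integral_complex_ofReal, Complex.ofReal_eq_zero,
    ← eval_mul] at hint
  rw [zonalMean_apply, average_eq, hint, smul_zero]

theorem zonalMean_one (hd : 0 < d) (ξ : Sph d) : zonalMean ξ 1 = 1 := by
  have : NeZero (surf d) := ⟨fun h => (surf_real_univ_pos hd).ne' (by simp [h])⟩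
  simp [zonalMean_apply]

theorem zonalMean_sq (hd : 3 ≤ d) (ξ : Sph d) (k : ℕ) : zonalMean ξ (zonalOrtho d k ^ 2) = 1 := by
  induction k with
  | zero => rw [zonalOrtho_zero hd, one_pow, zonalMean_one (by omega)]
  | succ k ih =>
    have hleft : zonalMean ξ (X * zonalOrtho d k * zonalOrtho d (k + 1)) =
        zonalJacobi d k * zonalMean ξ (zonalOrtho d (k + 1) ^ 2) := by
      cases k with
      | zero => rw [X_mul_zonalOrtho_zero hd, mul_assoc, zonalMean_C_mul, ← sq]
      | succ k =>
        rw [X_mul_zonalOrtho_succ hd, add_mul, map_add, mul_assoc, mul_assoc, zonalMean_C_mul,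
          zonalMean_C_mul, zonalMean_mul_of_ne hd ξ (by omega : k ≠ k + 1 + 1), ← sq, mul_zero,
          add_zero]
    have hright : zonalMean ξ (X * zonalOrtho d k * zonalOrtho d (k + 1)) =
        zonalJacobi d k * zonalMean ξ (zonalOrtho d k ^ 2) := by
      rw [mul_right_comm, X_mul_zonalOrtho_succ hd, add_mul, map_add, mul_assoc, mul_assoc,
        zonalMean_C_mul, zonalMean_C_mul, zonalMean_mul_of_ne hd ξ (by omega : k + 2 ≠ k), ← sq,
        mul_zero, zero_add]
    rw [← ih]
    exact mul_left_cancel₀ (zonalJacobi_pos hd k).ne' (hleft.symm.trans hright)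

theorem zonalMean_X_sq_mul_sq_zero (hd : 3 ≤ d) (ξ : Sph d) :
    zonalMean ξ (X ^ 2 * zonalOrtho d 0 ^ 2) = zonalJacobi d 0 ^ 2 := by
  rw [← mul_pow, X_mul_zonalOrtho_zero hd, mul_pow, ← C_pow, zonalMean_C_mul, zonalMean_sq hd,
    mul_one]

theorem zonalMean_X_sq_mul_sq_succ (hd : 3 ≤ d) (ξ : Sph d) (k : ℕ) :
    zonalMean ξ (X ^ 2 * zonalOrtho d (k + 1) ^ 2) =
      zonalJacobi d (k + 1) ^ 2 + zonalJacobi d k ^ 2 := by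
  have hsq : X ^ 2 * zonalOrtho d (k + 1) ^ 2 =
      C (zonalJacobi d (k + 1) ^ 2) * zonalOrtho d (k + 2) ^ 2 +
        C (2 * zonalJacobi d (k + 1) * zonalJacobi d k) *
          (zonalOrtho d (k + 2) * zonalOrtho d k) +
        C (zonalJacobi d k ^ 2) * zonalOrtho d k ^ 2 := by
    rw [← mul_pow, X_mul_zonalOrtho_succ hd]
    simp only [C_mul, C_pow, C_ofNat]
    ring
  rw [hsq, map_add, map_add, zonalMean_C_mul, zonalMean_C_mul, zonalMean_C_mul, zonalMean_sq hd,
    zonalMean_sq hd, zonalMean_mul_of_ne hd ξ (by omega : k + 2 ≠ k)]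
  ring

theorem average_dot_sq (hd : 3 ≤ d) (ξ : Sph d) : ⨍ η, dot ξ η ^ 2 ∂(surf d) = 1 / d := by
  have hmean := zonalMean_X_sq_mul_sq_zero hd ξ
  rw [zonalJacobi_sq hd, zonalDown_zero hd, zonalOrtho_zero hd, zonalMean_apply] at hmean
  simpa [zonalUp] using hmean

theorem summable_abs_zonalJacobi_sq_sub (hd : 3 ≤ d) :
    Summable fun k => |zonalJacobi d k ^ 2 - 1 / 4| := by
  have hd' : (3 : ℝ) ≤ d := mod_cast hd
  have hsum : Summable fun k : ℕ => |((d : ℝ) - 2) * (4 - d) / 4| * (1 / ((k + 1 : ℕ) : ℝ) ^ 2) :=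
    ((summable_nat_add_iff 1).mpr (Real.summable_one_div_nat_pow.mpr one_lt_two)).mul_left _
  refine hsum.of_nonneg_of_le (fun _ => abs_nonneg _) fun k => ?_
  have hden : 0 < 2 * (k : ℝ) + d - 2 := by linarith
  have hdev : zonalJacobi d k ^ 2 - 1 / 4 =
      ((d : ℝ) - 2) * (4 - d) / 4 * (1 / ((2 * k + d) * (2 * k + d - 2))) := by
    rw [zonalJacobi_sq hd, zonalUp, zonalDown, eq_comm]
    field_simp [hden.ne']
    ring
  rw [hdev, abs_mul, abs_of_nonneg (by positivity : 0 ≤ 1 / ((2 * k + d) * (2 * k + d - 2 : ℝ)))]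
  gcongr
  push_cast
  nlinarith

theorem tendsto_zonalJacobi_sq (hd : 3 ≤ d) :
    Tendsto (fun k => zonalJacobi d k ^ 2) atTop (𝓝 (1 / 4)) := by
  rw [tendsto_iff_dist_tendsto_zero]
  exact (summable_abs_zonalJacobi_sq_sub hd).tendsto_atTop_zero

theorem bddAbove_range_zonalOrtho_eval_sq (hd : 3 ≤ d) {t : ℝ} (ht : |t| < 1) :
    BddAbove (Set.range fun k => (zonalOrtho d k).eval t ^ 2) := by
  have hrec (k : ℕ) : t * (zonalOrtho d (k + 1)).eval t =
      zonalJacobi d (k + 1) * (zonalOrtho d (k + 2)).eval t +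
        zonalJacobi d k * (zonalOrtho d k).eval t := by
    simpa using congrArg (eval t) (X_mul_zonalOrtho_succ hd k)
  have hlim : Tendsto (zonalJacobi d) atTop (𝓝 (1 / 2)) := by
    have h := (tendsto_zonalJacobi_sq hd).sqrt
    rw [show (1 / 4 : ℝ) = (1 / 2) ^ 2 by norm_num, Real.sqrt_sq (by norm_num)] at h
    exact h.congr fun k => Real.sqrt_sq (zonalJacobi_pos hd k).le
  have hdev := summable_abs_zonalJacobi_sq_sub hd
  have hsum : Summable fun k => |zonalJacobi d (k + 1) ^ 2 - zonalJacobi d k ^ 2| :=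
    (((summable_nat_add_iff 1).mpr hdev).add hdev).of_nonneg_of_le (fun _ => abs_nonneg _)
      fun k => (abs_sub_le _ (1 / 4) _).trans (by rw [abs_sub_comm (1 / 4 : ℝ)])
  exact bddAbove_range_sq_of_jacobi hrec hlim hsum (by linarith)

theorem tendsto_zonalMean_X_sq_mul_sq (hd : 3 ≤ d) (ξ : Sph d) :
    Tendsto (fun k => zonalMean ξ (X ^ 2 * zonalOrtho d k ^ 2)) atTop (𝓝 (1 / 2)) := by
  rw [← tendsto_add_atTop_iff_nat 1]
  simp only [zonalMean_X_sq_mul_sq_succ hd]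
  have hlim := tendsto_zonalJacobi_sq hd
  convert ((tendsto_add_atTop_iff_nat 1).mpr hlim).add hlim using 2
  norm_num

theorem tendsto_harmDim (hd : 3 ≤ d) : Tendsto (harmDim d) atTop atTop := by
  have hd' : (3 : ℝ) ≤ d := mod_cast hd
  have hle (k : ℕ) : k / ((d - 2).factorial : ℝ) ≤ harmDim d k := by
    have hfact : (k.factorial : ℝ) ≤ (k + d - 3).factorial :=
      mod_cast Nat.factorial_le (by omega)
    calc k / ((d - 2).factorial : ℝ)
        = k * k.factorial / (k.factorial * (d - 2).factorial) := by field_simp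
      _ ≤ harmDim d k := by
        unfold harmDim
        gcongr <;> linarith
  exact tendsto_atTop_mono hle (tendsto_natCast_atTop_atTop.atTop_div_const (by positivity))

end OrthonormalZonalPolynomials

section ApproximateIdentity

theorem tendstoUniformly_integral_smul_of_small_off_diagonal {X E ι : Type*}
    [PseudoMetricSpace X] [CompactSpace X] [MeasurableSpace X] [BorelSpace X]
    [NormedAddCommGroup E] [NormedSpace ℝ E] [CompleteSpace E] {μ : Measure X} [IsFiniteMeasure μ]
    {l : Filter ι} {K : ι → X → X → ℝ} (hK : ∀ i x, Integrable (K i x) μ)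
    (hK_nonneg : ∀ i x y, 0 ≤ K i x y) (hK_integral : ∀ i x, ∫ y, K i x y ∂μ = 1)
    (hK_small : ∀ δ > 0, ∀ ε > 0, ∀ᶠ i in l, ∀ x y, δ ≤ dist x y → K i x y ≤ ε) (f : C(X, E)) :
    TendstoUniformly (fun i x => ∫ y, K i x y • f y ∂μ) f l := by
  rw [Metric.tendstoUniformly_iff]
  intro ε hε
  obtain ⟨δ, hδ, hf⟩ := Metric.uniformContinuous_iff.mp
    (CompactSpace.uniformContinuous_of_continuous f.continuous) (ε / 2) (half_pos hε)
  obtain ⟨κ, hκ, hκε⟩ := exists_pos_mul_lt (half_pos hε) (2 * ‖f‖ * μ.real Set.univ)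
  filter_upwards [hK_small δ hδ κ hκ] with i hi x
  have hsmul (v : E) : Integrable (fun y => K i x y • v) μ := (hK i x).smul_const v
  have hsmulf : Integrable (fun y => K i x y • f y) μ :=
    (hK i x).smul_bdd ‖f‖ f.continuous.aestronglyMeasurable (.of_forall f.norm_coe_le_norm)
  have hbound (y : X) : ‖K i x y • (f y - f x)‖ ≤ ε / 2 * K i x y + κ * (2 * ‖f‖) := by
    have hKy := hK_nonneg i x y
    rw [norm_smul, Real.norm_of_nonneg hKy]
    obtain hxy | hxy := lt_or_ge (dist x y) δ
    · have hclose := (hf (dist_comm x y ▸ hxy)).le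
      rw [dist_eq_norm] at hclose
      nlinarith [mul_le_mul_of_nonneg_left hclose hKy, norm_nonneg f, mul_nonneg hκ.le
        (norm_nonneg f)]
    · have hdiff : ‖f y - f x‖ ≤ 2 * ‖f‖ := by
        linarith [norm_sub_le (f y) (f x), f.norm_coe_le_norm y, f.norm_coe_le_norm x]
      nlinarith [mul_le_mul (hi x y hxy) hdiff (norm_nonneg _) hκ.le, mul_nonneg hε.le hKy]
  calc dist (f x) (∫ y, K i x y • f y ∂μ)
      = ‖∫ y, K i x y • (f y - f x) ∂μ‖ := by
        simp only [smul_sub]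
        rw [dist_comm, dist_eq_norm, integral_sub hsmulf (hsmul _), integral_smul_const,
          hK_integral, one_smul]
    _ ≤ ∫ y, (ε / 2 * K i x y + κ * (2 * ‖f‖)) ∂μ :=
        norm_integral_le_of_norm_le (((hK i x).const_mul _).add (integrable_const _))
          (.of_forall hbound)
    _ = ε / 2 + 2 * ‖f‖ * μ.real Set.univ * κ := by
        rw [integral_add ((hK i x).const_mul _) (integrable_const _), integral_const_mul,
          hK_integral, integral_const, smul_eq_mul]
        ring
    _ < ε := by linarith

end ApproximateIdentity

section Kernel

variable {d : ℕ}

theorem weight_pos (d n k : ℕ) : 0 < weight d n k := by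
  unfold weight
  positivity

theorem weight_zero (d n : ℕ) : weight d n 0 = 1 := by
  rw [weight, Nat.sub_zero, Nat.add_zero]
  exact div_self (by positivity)

theorem weight_succ (hd : 3 ≤ d) {n k : ℕ} (hk : k < n) :
    weight d n (k + 1) = weight d n k * ((n - k) / (n + k + d - 1)) := by
  obtain ⟨m, rfl⟩ := Nat.exists_eq_add_of_le' hd
  obtain ⟨j, rfl⟩ := Nat.exists_eq_add_of_le hk
  simp only [weight, show k + 1 + j - (k + 1) = j by omega, show k + 1 + j - k = j + 1 by omega,
    show k + 1 + j + (k + 1) + (m + 3) - 2 = (k + 1 + j + k + m + 1) + 1 by omega,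
    show k + 1 + j + k + (m + 3) - 2 = k + 1 + j + k + m + 1 by omega, Nat.factorial_succ]
  push_cast
  rw [show (k + 1 + j - k : ℝ) = j + 1 by ring,
    show (k + 1 + j + k + (m + 3) - 1 : ℝ) = k + 1 + j + k + m + 1 + 1 by ring]
  field_simp

theorem weight_succ_left (hd : 3 ≤ d) {n k : ℕ} (hk : k ≤ n) :
    weight d (n + 1) k =
      weight d n k * ((n + 1) * (n + d - 1) / ((n + 1 - k) * (n + k + d - 1))) := by
  obtain ⟨m, rfl⟩ := Nat.exists_eq_add_of_le' hd
  obtain ⟨j, rfl⟩ := Nat.exists_eq_add_of_le hk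
  simp only [weight, show k + j + 1 - k = j + 1 by omega, show k + j - k = j by omega,
    show k + j + 1 + k + (m + 3) - 2 = (k + j + k + m + 1) + 1 by omega,
    show k + j + k + (m + 3) - 2 = k + j + k + m + 1 by omega,
    show k + j + 1 + (m + 3) - 2 = (k + j + m + 1) + 1 by omega,
    show k + j + (m + 3) - 2 = k + j + m + 1 by omega, Nat.factorial_succ]
  push_cast
  rw [show (k + j + 1 - k : ℝ) = j + 1 by ring,
    show (k + j + k + (m + 3) - 1 : ℝ) = k + j + k + m + 1 + 1 by ring,
    show (k + j + (m + 3) - 1 : ℝ) = k + j + m + 1 + 1 by ring]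
  field_simp

theorem tendsto_weight (hd : 3 ≤ d) (k : ℕ) : Tendsto (fun n => weight d n k) atTop (𝓝 1) := by
  induction k with
  | zero => simp [weight_zero]
  | succ k ih =>
    have hden : Tendsto (fun n : ℕ => (n + k + d - 1 : ℝ)) atTop atTop := by
      simpa only [add_sub_assoc, add_assoc] using
        tendsto_natCast_atTop_atTop.atTop_add (tendsto_const_nhds (x := (k + (d - 1) : ℝ)))
    have hratio : Tendsto (fun n : ℕ => 1 - (2 * k + d - 1 : ℝ) / (n + k + d - 1)) atTop (𝓝 1) := by
      simpa using tendsto_const_nhds.sub (tendsto_const_nhds.div_atTop hden)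
    have hprod := ih.mul hratio
    rw [one_mul] at hprod
    refine hprod.congr' ?_
    filter_upwards [hden.eventually_gt_atTop 0, eventually_gt_atTop k] with n hn hkn
    rw [weight_succ hd hkn, one_sub_div hn.ne']
    ring

theorem mul_weight_succ_succ (hd : 3 ≤ d) {n j : ℕ} (hj : j < n) :
    (2 * n + d - 1) / (n + d - 1) * weight d (n + 1) (j + 1) =
      weight d n (j + 1) + weight d n j * zonalUp d j +
        weight d n (j + 1) * ((n - (j + 1)) / (n + j + d)) * zonalDown d (j + 1) := by
  have hd' : (3 : ℝ) ≤ d := mod_cast hd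
  have hjn : (j : ℝ) + 1 ≤ n := mod_cast hj
  have hsub : (0 : ℝ) < n - j := by linarith
  have hnd : (0 : ℝ) < n + d - 1 := by linarith
  have hnjd : (0 : ℝ) < n + j + d - 1 := by linarith
  rw [weight_succ_left hd hj, weight_succ hd hj, zonalDown, zonalUp]
  push_cast
  rw [show (n + 1 - (j + 1) : ℝ) = n - j by ring,
    show (n + (j + 1) + d - 1 : ℝ) = n + j + d by ring,
    show (2 * (j + 1) + d - 2 : ℝ) = 2 * j + d by ring]
  field_simp
  ring

theorem mul_weight_succ_self (hd : 3 ≤ d) (n : ℕ) :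
    (2 * n + d - 1) / (n + d - 1) * weight d (n + 1) (n + 1) = weight d n n * zonalUp d n := by
  have hd' : (3 : ℝ) ≤ d := mod_cast hd
  have hnd : (0 : ℝ) < n + d - 1 := by linarith
  have hnd' : (0 : ℝ) < 2 * n + d - 1 := by linarith
  rw [weight_succ hd n.lt_succ_self, weight_succ_left hd le_rfl, zonalUp]
  push_cast
  rw [show (n + 1 + n + d - 1 : ℝ) = 2 * n + d by ring,
    show (n + n + d - 1 : ℝ) = 2 * n + d - 1 by ring, show (n + 1 - n : ℝ) = 1 by ring]
  field_simp

theorem one_add_mul_sum_weight (hd : 3 ≤ d) (n : ℕ) (t : ℝ) {j : ℕ} (hj : j ≤ n) :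
    (1 + t) * ∑ k ∈ Finset.range (j + 1), weight d n k * (zonalPoly d k).eval t =
      (2 * n + d - 1) / (n + d - 1) *
        ∑ k ∈ Finset.range (j + 1), weight d (n + 1) k * (zonalPoly d k).eval t
      + weight d n j * (zonalUp d j * (zonalPoly d (j + 1)).eval t
        - (n - j) / (n + j + d - 1) * zonalDown d j * (zonalPoly d j).eval t) := by
  induction j with
  | zero =>
    have hd' : (3 : ℝ) ≤ d := mod_cast hd
    have hnd : (0 : ℝ) < n + d - 1 := by linarith [n.cast_nonneg (α := ℝ)]
    have hrec := congrArg (Polynomial.eval t) (X_mul_zonalPoly_zero hd)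
    have hratio : (2 * n + d - 1) / (n + d - 1) - n / (n + d - 1) = (1 : ℝ) := by
      rw [← sub_div, div_eq_one_iff_eq hnd.ne']
      ring
    simp only [zonalPoly_zero hd, mul_one, Polynomial.eval_X, Polynomial.eval_mul,
      Polynomial.eval_C, zero_add, Finset.range_one, Finset.sum_singleton, weight_zero,
      Polynomial.eval_one, CharP.cast_eq_zero, sub_zero, add_zero, zonalDown_zero hd,
      one_mul] at hrec ⊢
    linear_combination hrec - hratio
  | succ j ih =>
    have hrec := congrArg (Polynomial.eval t) (X_mul_zonalPoly_succ hd j)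
    simp only [Polynomial.eval_mul, Polynomial.eval_add, Polynomial.eval_C,
      Polynomial.eval_X] at hrec
    rw [Finset.sum_range_succ, mul_add, ih (by omega), Finset.sum_range_succ _ (j + 1), mul_add]
    push_cast
    rw [show (n + (j + 1) + d - 1 : ℝ) = n + j + d by ring]
    linear_combination -(zonalPoly d (j + 1)).eval t * mul_weight_succ_succ hd hj
      + weight d n (j + 1) * hrec
      + zonalDown d j * (zonalPoly d j).eval t * weight_succ hd hj

/-- The mean over the sphere of `((1 + ξ · η) / 2)^n`, a power which is up to this constant the
kernel `diracKernel d n` (the de la Vallée-Poussin kernel). -/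
def valleePoussinConst (d : ℕ) : ℕ → ℝ
  | 0 => 1
  | n + 1 => valleePoussinConst d n * ((2 * n + d - 1) / (2 * (n + d - 1)))

theorem valleePoussinConst_pos (hd : 3 ≤ d) (n : ℕ) : 0 < valleePoussinConst d n := by
  have hd' : (3 : ℝ) ≤ d := mod_cast hd
  induction n with
  | zero => exact one_pos
  | succ n ih =>
    exact mul_pos ih (div_pos (by linarith) (by linarith))

theorem sum_weight_mul_zonalPoly (hd : 3 ≤ d) (n : ℕ) (t : ℝ) :
    ∑ k ∈ Finset.range (n + 1), weight d n k * (zonalPoly d k).eval t =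
      ((1 + t) / 2) ^ n / valleePoussinConst d n := by
  induction n with
  | zero => simp [weight_zero, zonalPoly_zero hd, valleePoussinConst]
  | succ n ih =>
    have hd' : (3 : ℝ) ≤ d := mod_cast hd
    have hnd : (0 : ℝ) < n + d - 1 := by linarith
    have hnd' : (0 : ℝ) < 2 * n + d - 1 := by linarith
    have hc := (valleePoussinConst_pos hd n).ne'
    have hstep : (2 * n + d - 1) / (n + d - 1) *
        ∑ k ∈ Finset.range (n + 1 + 1), weight d (n + 1) k * (zonalPoly d k).eval t =
          (1 + t) * (((1 + t) / 2) ^ n / valleePoussinConst d n) := by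
      have hsum := one_add_mul_sum_weight hd n t le_rfl
      rw [ih, sub_self] at hsum
      rw [Finset.sum_range_succ, mul_add]
      linear_combination -hsum + (zonalPoly d (n + 1)).eval t * mul_weight_succ_self hd n
    apply mul_left_cancel₀ (div_pos hnd' hnd).ne'
    rw [hstep, valleePoussinConst]
    field_simp
    ring

theorem diracKernel_eq (hd : 3 ≤ d) (n : ℕ) (ξ η : Sph d) :
    diracKernel d n ξ η =
      ((1 + dot ξ η) / 2) ^ n / (valleePoussinConst d n * (surf d).real Set.univ) := by
  rw [diracKernel, ← div_div, ← sum_weight_mul_zonalPoly hd, Finset.sum_div]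
  exact Finset.sum_congr rfl fun k _ => by rw [zonal_eq hd, mul_div_assoc]

theorem one_add_dot_div_two_nonneg (ξ η : Sph d) : 0 ≤ (1 + dot ξ η) / 2 := by
  linarith [(abs_le.mp (abs_dot_le_one ξ η)).1]

theorem diracKernel_nonneg (hd : 3 ≤ d) (n : ℕ) (ξ η : Sph d) : 0 ≤ diracKernel d n ξ η := by
  have hc := valleePoussinConst_pos hd n
  have hS := surf_real_univ_pos (by omega : 0 < d)
  have hdot := one_add_dot_div_two_nonneg ξ η
  rw [diracKernel_eq hd]
  positivity

theorem integrable_diracKernel (hd : 3 ≤ d) (n : ℕ) (ξ : Sph d) :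
    Integrable (diracKernel d n ξ) (surf d) := by
  rw [funext fun η => diracKernel_eq hd n ξ η]
  exact integrable_of_continuous
    ((((continuous_dot_right ξ).const_add 1).div_const 2).pow n |>.div_const _)

theorem integral_zonal (hd : 3 ≤ d) (k : ℕ) (ξ : Sph d) :
    ∫ η, zonal d k ξ η ∂(surf d) = if k = 0 then 1 else 0 := by
  have hmean : ∫ η, zonal d k ξ η ∂(surf d) =
      √(harmDim d k) * zonalMean ξ (zonalOrtho d k * zonalOrtho d 0) := by
    rw [zonalMean_apply, average_eq, smul_eq_mul, ← mul_assoc, ← integral_const_mul]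
    refine integral_congr_ae (.of_forall fun η => ?_)
    simp only [zonal_eq hd, zonalPoly_eval_eq hd, zonalOrtho_zero hd, mul_one]
    ring
  rw [hmean]
  split_ifs with hk
  · rw [hk, ← sq, zonalMean_sq hd, harmDim_zero hd, Real.sqrt_one, one_mul]
  · rw [zonalMean_mul_of_ne hd ξ hk, mul_zero]

theorem integral_diracKernel (hd : 3 ≤ d) (n : ℕ) (ξ : Sph d) :
    ∫ η, diracKernel d n ξ η ∂(surf d) = 1 := by
  have hint (k : ℕ) : Integrable (fun η => weight d n k * zonal d k ξ η) (surf d) := by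
    simp only [zonal_eq hd]
    exact (integrable_of_continuous ((continuous_eval_dot _ ξ).div_const _)).const_mul _
  unfold diracKernel
  rw [integral_finsetSum _ fun k _ => hint k]
  simp [integral_const_mul, integral_zonal hd, weight_zero]

theorem tendsto_pow_div_valleePoussinConst (hd : 3 ≤ d) {q : ℝ} (hq₀ : 0 < q) (hq : q < 1) :
    Tendsto (fun n => q ^ n / valleePoussinConst d n) atTop (𝓝 0) := by
  have hd' : (3 : ℝ) ≤ d := mod_cast hd
  have hpos (n : ℕ) : 0 < q ^ n / valleePoussinConst d n :=
    div_pos (pow_pos hq₀ n) (valleePoussinConst_pos hd n)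
  have hden : Tendsto (fun n : ℕ => (2 * n + d - 1 : ℝ)) atTop atTop := by
    refine tendsto_atTop_mono (fun n => ?_) tendsto_natCast_atTop_atTop
    linarith [n.cast_nonneg (α := ℝ)]
  have hratio : Tendsto (fun n : ℕ => q * (1 + (d - 1 : ℝ) / (2 * n + d - 1))) atTop (𝓝 q) := by
    simpa using ((tendsto_const_nhds.div_atTop hden).const_add 1).const_mul q
  refine (summable_of_ratio_test_tendsto_lt_one hq (.of_forall fun n => (hpos n).ne')
    (hratio.congr fun n => ?_)).tendsto_atTop_zero
  have hc := (valleePoussinConst_pos hd n).ne'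
  have hnd' : (0 : ℝ) < 2 * n + d - 1 := by linarith
  rw [Real.norm_of_nonneg (hpos _).le, Real.norm_of_nonneg (hpos _).le, valleePoussinConst]
  field_simp
  ring

theorem eventually_diracKernel_le (hd : 3 ≤ d) {δ ε : ℝ} (hδ : 0 < δ) (hε : 0 < ε) :
    ∀ᶠ n in atTop, ∀ ξ η : Sph d, δ ≤ dist ξ η → diracKernel d n ξ η ≤ ε := by
  have hS := surf_real_univ_pos (by omega : 0 < d)
  set q := max (1 / 2) (1 - δ ^ 2 / 4)
  have hq₀ : 0 < q := lt_max_of_lt_left one_half_pos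
  have hq : q < 1 := max_lt one_half_lt_one (by linarith [pow_pos hδ 2])
  have hlim := (tendsto_pow_div_valleePoussinConst hd hq₀ hq).div_const ((surf d).real Set.univ)
  rw [zero_div] at hlim
  filter_upwards [hlim.eventually_le_const hε] with n hn ξ η hdist
  have hc := valleePoussinConst_pos hd n
  have hdot := one_add_dot_div_two_nonneg ξ η
  have hbase : (1 + dot ξ η) / 2 ≤ q := by
    have hsq := pow_le_pow_left₀ hδ.le hdist 2
    rw [dist_sq_eq] at hsq
    exact le_max_of_le_right (by linarith)
  calc diracKernel d n ξ η
      = ((1 + dot ξ η) / 2) ^ n / (valleePoussinConst d n * (surf d).real Set.univ) :=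
        diracKernel_eq hd n ξ η
    _ ≤ q ^ n / (valleePoussinConst d n * (surf d).real Set.univ) := by gcongr
    _ ≤ ε := by rwa [← div_div]

theorem tendstoUniformly_integral_diracKernel (hd : 3 ≤ d) (f : C(Sph d, ℂ)) :
    TendstoUniformly
      (fun (n : ℕ) (ζ : Sph d) => ∫ η, (diracKernel d n ζ η : ℂ) * f η ∂(surf d)) f atTop := by
  simp only [← Complex.real_smul]
  exact tendstoUniformly_integral_smul_of_small_off_diagonal (integrable_diracKernel hd)
    (diracKernel_nonneg hd) (integral_diracKernel hd)
    (fun _ hδ _ hε => eventually_diracKernel_le hd hδ hε) f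

end Kernel

section TimeAverage

/-- The time average of `f` over the half-line exists and equals `m`. -/
def HasTimeAverage (f : ℝ → ℝ) (m : ℝ) : Prop :=
  Tendsto (fun T : ℝ => 1 / T * ∫ t in (0 : ℝ)..T, f t) atTop (𝓝 m)

theorem hasTimeAverage_const (m : ℝ) : HasTimeAverage (fun _ => m) m := by
  refine tendsto_const_nhds.congr' ?_
  filter_upwards [eventually_gt_atTop 0] with T hT
  simp [hT.ne']

theorem HasTimeAverage.const_mul {f : ℝ → ℝ} {m : ℝ} (hf : HasTimeAverage f m) (c : ℝ) :
    HasTimeAverage (fun t => c * f t) (c * m) := by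
  refine (Tendsto.const_mul c hf).congr fun T => ?_
  rw [intervalIntegral.integral_const_mul, mul_left_comm]

theorem HasTimeAverage.sum {ι : Type*} {s : Finset ι} {f : ι → ℝ → ℝ} {m : ι → ℝ}
    (hf : ∀ i ∈ s, HasTimeAverage (f i) (m i)) (hcont : ∀ i ∈ s, Continuous (f i)) :
    HasTimeAverage (fun t => ∑ i ∈ s, f i t) (∑ i ∈ s, m i) := by
  refine (tendsto_finsetSum s hf).congr fun T => ?_
  rw [intervalIntegral.integral_finsetSum fun i hi => (hcont i hi).intervalIntegrable 0 T,
    Finset.mul_sum]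

theorem hasTimeAverage_cos {w : ℝ} (hw : w ≠ 0) : HasTimeAverage (fun t => Real.cos (w * t)) 0 := by
  have hmean (T : ℝ) : 1 / T * ∫ t in (0 : ℝ)..T, Real.cos (w * t) =
      T⁻¹ * (w⁻¹ * Real.sin (w * T)) := by
    rw [intervalIntegral.integral_comp_mul_left _ hw]
    simp
  simp only [HasTimeAverage, hmean]
  refine tendsto_inv_atTop_zero.zero_mul_isBoundedUnder_le ?_
  refine isBoundedUnder_of ⟨|w⁻¹|, fun T => ?_⟩
  rw [Function.comp_apply, norm_mul, Real.norm_eq_abs, Real.norm_eq_abs]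
  exact mul_le_of_le_one_right (abs_nonneg _) (Real.abs_sin_le_one _)

variable {ι : Type*} {s : Finset ι} {lam : ι → ℝ}

theorem hasTimeAverage_sum_cos (hlam : Set.InjOn lam s) (m : ι → ι → ℝ) :
    HasTimeAverage (fun t => ∑ j ∈ s, ∑ k ∈ s, m j k * Real.cos ((lam j - lam k) * t))
      (∑ k ∈ s, m k k) := by
  classical
  have hdiag : ∑ k ∈ s, m k k = ∑ j ∈ s, ∑ k ∈ s, m j k * if j = k then 1 else 0 :=
    Finset.sum_congr rfl fun j hj => by simp [hj]
  rw [hdiag]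
  refine .sum (fun j hj => .sum (fun k hk => .const_mul ?_ _) fun k _ => by fun_prop)
    fun j _ => by fun_prop
  split_ifs with h
  · simpa [h] using hasTimeAverage_const 1
  · exact hasTimeAverage_cos (sub_ne_zero.mpr fun he => h (hlam hj hk he))

theorem norm_sq_sum_mul_exp (s : Finset ι) (lam b : ι → ℝ) (t : ℝ) :
    ‖∑ k ∈ s, (b k : ℂ) * Complex.exp (-(Complex.I * t * lam k))‖ ^ 2 =
      ∑ j ∈ s, ∑ k ∈ s, b j * b k * Real.cos ((lam j - lam k) * t) := by
  have hterm (k : ι) : (b k : ℂ) * Complex.exp (-(Complex.I * t * lam k)) =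
      ((b k * Real.cos (lam k * t) : ℝ) : ℂ) +
        ((-(b k * Real.sin (lam k * t)) : ℝ) : ℂ) * Complex.I := by
    rw [show -(Complex.I * t * lam k) = ((-(lam k * t) : ℝ) : ℂ) * Complex.I by push_cast; ring,
      Complex.exp_mul_I, ← Complex.ofReal_cos, ← Complex.ofReal_sin, Real.cos_neg, Real.sin_neg]
    push_cast
    ring
  simp only [hterm]
  rw [Finset.sum_add_distrib, ← Finset.sum_mul, ← Complex.ofReal_sum, ← Complex.ofReal_sum,
    ← Complex.normSq_eq_norm_sq, Complex.normSq_add_mul_I, pow_two, pow_two, Finset.sum_mul_sum,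
    Finset.sum_mul_sum, ← Finset.sum_add_distrib]
  refine Finset.sum_congr rfl fun j _ => ?_
  rw [← Finset.sum_add_distrib]
  refine Finset.sum_congr rfl fun k _ => ?_
  rw [sub_mul, Real.cos_sub]
  ring

theorem hasTimeAverage_norm_sq_sum_mul_exp (hlam : Set.InjOn lam s) (b : ι → ℝ) :
    HasTimeAverage
      (fun t => ‖∑ k ∈ s, (b k : ℂ) * Complex.exp (-(Complex.I * t * lam k))‖ ^ 2)
      (∑ k ∈ s, b k ^ 2) := by
  simp only [norm_sq_sum_mul_exp]
  simpa only [pow_two] using hasTimeAverage_sum_cos hlam fun j k => b j * b k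

theorem hasTimeAverage_integral_mul_norm_sq_sum_mul_exp {α : Type*} [MeasurableSpace α]
    {μ : Measure α} (hlam : Set.InjOn lam s) {a : α → ℝ} {b : ι → α → ℝ}
    (hint : ∀ j k, Integrable (fun x => a x * (b j x * b k x)) μ) :
    HasTimeAverage
      (fun t => ∫ x, a x *
        ‖∑ k ∈ s, (b k x : ℂ) * Complex.exp (-(Complex.I * t * lam k))‖ ^ 2 ∂μ)
      (∫ x, a x * ∑ k ∈ s, b k x ^ 2 ∂μ) := by
  have hdensity (t : ℝ) : ∫ x, a x *
      ‖∑ k ∈ s, (b k x : ℂ) * Complex.exp (-(Complex.I * t * lam k))‖ ^ 2 ∂μ =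
      ∑ j ∈ s, ∑ k ∈ s, (∫ x, a x * (b j x * b k x) ∂μ) * Real.cos ((lam j - lam k) * t) := by
    simp only [norm_sq_sum_mul_exp s lam (fun k => b k _), Finset.mul_sum,
      ← mul_assoc (a _) (_ * _)]
    rw [integral_finsetSum _ fun j _ => integrable_finsetSum _ fun k _ => (hint j k).mul_const _]
    refine Finset.sum_congr rfl fun j _ => ?_
    rw [integral_finsetSum _ fun k _ => (hint j k).mul_const _]
    simp only [integral_mul_const]
  have hmean : ∫ x, a x * ∑ k ∈ s, b k x ^ 2 ∂μ =
      ∑ k ∈ s, ∫ x, a x * (b k x * b k x) ∂μ := by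
    simp only [Finset.mul_sum, pow_two]
    exact integral_finsetSum _ fun k _ => hint k k
  simp only [hdensity, hmean]
  exact hasTimeAverage_sum_cos hlam _

end TimeAverage

section WeightedAverages

variable {w : ℕ → ℕ → ℝ} {x : ℕ → ℝ}

theorem eventually_lt_sum_mul (hw₀ : ∀ n k, 0 ≤ w n k)
    (hw₁ : ∀ n, ∑ k ∈ Finset.range (n + 1), w n k = 1)
    (hw : ∀ k, Tendsto (fun n => w n k) atTop (𝓝 0)) {b c : ℝ} (hb : ∀ᶠ k in atTop, b ≤ x k)
    (hc : c < b) : ∀ᶠ n in atTop, c < ∑ k ∈ Finset.range (n + 1), w n k * x k := by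
  obtain ⟨K, hK⟩ := eventually_atTop.mp hb
  have hhead : Tendsto (fun n => ∑ k ∈ Finset.range K, w n k * (x k - b)) atTop (𝓝 0) := by
    simpa using tendsto_finsetSum (Finset.range K) fun k _ => (hw k).mul_const (x k - b)
  filter_upwards [hhead.eventually_const_lt (sub_neg.mpr hc), eventually_ge_atTop K] with n hlt hn
  have htail : ∑ k ∈ Finset.range K, w n k * (x k - b) ≤
      ∑ k ∈ Finset.range (n + 1), w n k * (x k - b) := by
    refine Finset.sum_le_sum_of_subset_of_nonneg (Finset.range_subset_range.mpr (by omega))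
      fun k _ hk => mul_nonneg (hw₀ n k) (sub_nonneg.mpr (hK k ?_))
    simpa using hk
  have hshift : ∑ k ∈ Finset.range (n + 1), w n k * (x k - b) =
      ∑ k ∈ Finset.range (n + 1), w n k * x k - b := by
    simp only [mul_sub, Finset.sum_sub_distrib, ← Finset.sum_mul, hw₁ n, one_mul]
  linarith

theorem tendsto_sum_mul_atTop (hw₀ : ∀ n k, 0 ≤ w n k)
    (hw₁ : ∀ n, ∑ k ∈ Finset.range (n + 1), w n k = 1)
    (hw : ∀ k, Tendsto (fun n => w n k) atTop (𝓝 0)) (hx : Tendsto x atTop atTop) :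
    Tendsto (fun n => ∑ k ∈ Finset.range (n + 1), w n k * x k) atTop atTop :=
  tendsto_atTop.mpr fun b =>
    (eventually_lt_sum_mul hw₀ hw₁ hw (hx.eventually_ge_atTop (b + 1)) (lt_add_one b)).mono
      fun _ => le_of_lt

theorem tendsto_sum_mul_nhds (hw₀ : ∀ n k, 0 ≤ w n k)
    (hw₁ : ∀ n, ∑ k ∈ Finset.range (n + 1), w n k = 1)
    (hw : ∀ k, Tendsto (fun n => w n k) atTop (𝓝 0)) {L : ℝ} (hx : Tendsto x atTop (𝓝 L)) :
    Tendsto (fun n => ∑ k ∈ Finset.range (n + 1), w n k * x k) atTop (𝓝 L) := by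
  refine tendsto_order.mpr ⟨fun c hc => ?_, fun c hc => ?_⟩ <;>
    obtain ⟨b, h₁, h₂⟩ := exists_between hc
  · exact eventually_lt_sum_mul hw₀ hw₁ hw (hx.eventually_const_le h₂) h₁
  · have hneg : ∀ᶠ k in atTop, -b ≤ -x k := (hx.eventually_le_const h₁).mono fun k => neg_le_neg
    filter_upwards [eventually_lt_sum_mul hw₀ hw₁ hw hneg (neg_lt_neg h₂)] with n hn
    simpa only [mul_neg, Finset.sum_neg_distrib, neg_lt_neg_iff] using hn

end WeightedAverages

section SpectralWeights

variable {d : ℕ}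

theorem normConst_pos (hd : 3 ≤ d) (n : ℕ) : 0 < normConst d n := by
  have hS := surf_real_univ_pos (by omega : 0 < d)
  exact Finset.sum_pos (fun k _ => mul_pos (pow_pos (weight_pos d n k) 2)
    (div_pos (harmDim_pos hd k) hS)) (by simp)

theorem tendsto_normConst (hd : 3 ≤ d) : Tendsto (normConst d) atTop atTop := by
  have hS := surf_real_univ_pos (by omega : 0 < d)
  refine tendsto_atTop.mpr fun b => ?_
  obtain ⟨k, hk⟩ := (((tendsto_harmDim hd).atTop_div_const hS).eventually_gt_atTop b).exists
  have hterm : Tendsto (fun n => weight d n k ^ 2 * (harmDim d k / (surf d).real Set.univ)) atTop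
      (𝓝 (harmDim d k / (surf d).real Set.univ)) := by
    simpa using ((tendsto_weight hd k).pow 2).mul_const (harmDim d k / (surf d).real Set.univ)
  filter_upwards [hterm.eventually_const_lt hk, eventually_ge_atTop k] with n hn hkn
  refine hn.le.trans (Finset.single_le_sum
    (f := fun j => weight d n j ^ 2 * (harmDim d j / (surf d).real Set.univ)) (fun j _ => ?_)
    (Finset.mem_range_succ_iff.mpr hkn))
  exact mul_nonneg (sq_nonneg _) (div_pos (harmDim_pos hd j) hS).le

/-- The coefficient of the approximate Dirac mass `S_ξ^{(n)}` at the zonal polynomial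
`zonalOrtho d k`. -/
def diracCoeff (d n k : ℕ) : ℝ :=
  weight d n k * √(harmDim d k) / ((surf d).real Set.univ * √(normConst d n))

/-- The squared `L²` norm of the component of degree `k` of `S_ξ^{(n)}`, for `k ≤ n`: the
distribution of the degree in the state `S_ξ^{(n)}`. -/
def spectralWeight (d n k : ℕ) : ℝ := (surf d).real Set.univ * diracCoeff d n k ^ 2

theorem spectralWeight_nonneg (d n k : ℕ) : 0 ≤ spectralWeight d n k :=
  mul_nonneg measureReal_nonneg (sq_nonneg _)

theorem spectralWeight_eq (hd : 3 ≤ d) (n k : ℕ) : spectralWeight d n k =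
    weight d n k ^ 2 * (harmDim d k / (surf d).real Set.univ) / normConst d n := by
  have hS := surf_real_univ_pos (by omega : 0 < d)
  rw [spectralWeight, diracCoeff, div_pow, mul_pow, mul_pow, Real.sq_sqrt (harmDim_pos hd k).le,
    Real.sq_sqrt (normConst_pos hd n).le]
  field_simp

theorem sum_spectralWeight (hd : 3 ≤ d) (n : ℕ) :
    ∑ k ∈ Finset.range (n + 1), spectralWeight d n k = 1 := by
  simp only [spectralWeight_eq hd, ← Finset.sum_div]
  exact div_self (normConst_pos hd n).ne'

theorem tendsto_spectralWeight (hd : 3 ≤ d) (k : ℕ) :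
    Tendsto (fun n => spectralWeight d n k) atTop (𝓝 0) := by
  simp only [spectralWeight_eq hd]
  exact (((tendsto_weight hd k).pow 2).mul_const _).div_atTop (tendsto_normConst hd)

end SpectralWeights

section Evolution

open Polynomial

variable {d : ℕ}

theorem integral_eval_dot (q : ℝ[X]) (ξ : Sph d) :
    ∫ η, q.eval (dot ξ η) ∂(surf d) = (surf d).real Set.univ * zonalMean ξ q := by
  rw [zonalMean_apply, ← smul_eq_mul, measure_smul_average]

/-- The zonal function with polynomial profile `q`, as a continuous map depending linearly on
`q`. -/
def zonalMap (ξ : Sph d) : ℝ[X] →ₗ[ℝ] C(Sph d, ℂ) where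
  toFun q := ⟨zonalFun q ξ, Complex.continuous_ofReal.comp (continuous_eval_dot q ξ)⟩
  map_add' p q := by
    ext η
    change zonalFun (p + q) ξ η = zonalFun p ξ η + zonalFun q ξ η
    simp [zonalFun]
  map_smul' c q := by
    ext η
    change zonalFun (c • q) ξ η = (c : ℂ) * zonalFun q ξ η
    simp [zonalFun]

theorem zonalMap_apply (q : ℝ[X]) (ξ η : Sph d) :
    zonalMap ξ q η = ((q.eval (dot ξ η) : ℝ) : ℂ) := rfl

/-- The zonal function with polynomial profile `q`, as an element of `L²`. -/
def zonalLp (ξ : Sph d) : ℝ[X] →ₗ[ℝ] Lp ℂ 2 (surf d) :=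
  (ContinuousMap.toLp 2 (surf d) ℂ).toLinearMap.restrictScalars ℝ ∘ₗ zonalMap ξ

theorem zonalLp_apply (q : ℝ[X]) (ξ : Sph d) :
    zonalLp ξ q = ContinuousMap.toLp 2 (surf d) ℂ (zonalMap ξ q) := rfl

theorem coeFn_zonalLp (q : ℝ[X]) (ξ : Sph d) : zonalLp ξ q =ᵐ[surf d] zonalFun q ξ :=
  ContinuousMap.coeFn_toLp _ (zonalMap ξ q)

theorem zonalLp_zonalOrtho_mem_eigenspace (ξ : Sph d) (k : ℕ) :
    zonalLp ξ (zonalOrtho d k) ∈ eigenspace d (sphereEigenvalue d k) :=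
  Submodule.le_topologicalClosure _ (Submodule.subset_span ⟨zonalFun (zonalOrtho d k) ξ,
    smoothOnSphere_zonalFun _ ξ, sphereLaplacian_zonalOrtho k ξ, coeFn_zonalLp _ ξ⟩)

theorem norm_zonalLp_sq (q : ℝ[X]) (ξ : Sph d) :
    ‖zonalLp ξ q‖ ^ 2 = (surf d).real Set.univ * zonalMean ξ (q ^ 2) := by
  have hinner : inner ℂ (zonalLp ξ q) (zonalLp ξ q) =
      ((∫ η, (q ^ 2).eval (dot ξ η) ∂(surf d) : ℝ) : ℂ) := by
    rw [L2.inner_def, ← integral_complex_ofReal]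
    refine integral_congr_ae ?_
    filter_upwards [coeFn_zonalLp q ξ] with η hη
    rw [hη, RCLike.inner_apply, zonalFun, Complex.conj_ofReal, ← Complex.ofReal_mul, ← pow_two,
      eval_pow]
  rw [@norm_sq_eq_re_inner ℂ, hinner, RCLike.re_to_complex, Complex.ofReal_re, integral_eval_dot]

/-- The polynomial profile of the zonal function `S_ξ^{(n)}`. -/
def diracPoly (d n : ℕ) : ℝ[X] := ∑ k ∈ Finset.range (n + 1), diracCoeff d n k • zonalOrtho d k

theorem diracMass_eq (hd : 3 ≤ d) (n : ℕ) (ξ : Sph d) :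
    diracMass d n ξ = zonalFun (diracPoly d n) ξ := by
  funext η
  simp only [diracMass, diracKernel, zonal_eq hd, zonalPoly_eval_eq hd, zonalFun, diracPoly,
    Finset.sum_div, eval_finsetSum, eval_smul, smul_eq_mul]
  congr 1
  refine Finset.sum_congr rfl fun k _ => ?_
  rw [diracCoeff]
  ring

theorem memLp_diracMass (hd : 3 ≤ d) (n : ℕ) (ξ : Sph d) :
    MemLp (diracMass d n ξ) 2 (surf d) := by
  rw [diracMass_eq hd]
  exact (memLp_congr_ae (coeFn_zonalLp _ ξ)).mp (Lp.memLp _)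

theorem toLp_diracMass (hd : 3 ≤ d) {n : ℕ} {ξ : Sph d} (hS : MemLp (diracMass d n ξ) 2 (surf d)) :
    hS.toLp (diracMass d n ξ) = zonalLp ξ (diracPoly d n) := by
  refine Lp.ext (hS.coeFn_toLp.trans ?_)
  rw [diracMass_eq hd]
  exact (coeFn_zonalLp _ ξ).symm

theorem zonalMean_diracPoly_sq (hd : 3 ≤ d) (n : ℕ) (ξ : Sph d) :
    zonalMean ξ (diracPoly d n ^ 2) = ∑ k ∈ Finset.range (n + 1), diracCoeff d n k ^ 2 := by
  rw [diracPoly, pow_two, Finset.sum_mul_sum, map_sum]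
  refine Finset.sum_congr rfl fun j hj => ?_
  rw [map_sum, Finset.sum_eq_single_of_mem j hj fun k _ hk => ?_]
  · rw [smul_mul_smul_comm, map_smul, ← pow_two, ← pow_two, zonalMean_sq hd, smul_eq_mul, mul_one]
  · rw [smul_mul_smul_comm, map_smul, zonalMean_mul_of_ne hd ξ hk.symm, smul_zero]

theorem norm_toLp_diracMass (hd : 3 ≤ d) {n : ℕ} {ξ : Sph d}
    (hS : MemLp (diracMass d n ξ) 2 (surf d)) : ‖hS.toLp (diracMass d n ξ)‖ = 1 := by
  rw [← pow_eq_one_iff_of_nonneg (norm_nonneg _) two_ne_zero, toLp_diracMass hd, norm_zonalLp_sq,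
    zonalMean_diracPoly_sq hd, Finset.mul_sum]
  exact sum_spectralWeight hd n

/-- The continuous version of the Schrödinger evolution of the approximate Dirac mass. -/
def evolution (ξ : Sph d) (n : ℕ) : C(ℝ × Sph d, ℂ) where
  toFun p := ∑ k ∈ Finset.range (n + 1),
    ((diracCoeff d n k * (zonalOrtho d k).eval (dot ξ p.2) : ℝ) : ℂ) *
      Complex.exp (-(Complex.I * p.1 * sphereEigenvalue d k))
  continuous_toFun := by
    have hcont (k : ℕ) : Continuous fun p : ℝ × Sph d => (zonalOrtho d k).eval (dot ξ p.2) :=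
      (continuous_eval_dot _ ξ).comp continuous_snd
    fun_prop

theorem evolution_apply (ξ : Sph d) (n : ℕ) (t : ℝ) (η : Sph d) :
    evolution ξ n (t, η) = ∑ k ∈ Finset.range (n + 1),
      ((diracCoeff d n k * (zonalOrtho d k).eval (dot ξ η) : ℝ) : ℂ) *
        Complex.exp (-(Complex.I * t * sphereEigenvalue d k)) := rfl

theorem schrodinger_diracMass_ae_eq (hd : 3 ≤ d) {n : ℕ} {ξ : Sph d}
    (hS : MemLp (diracMass d n ξ) 2 (surf d)) (t : ℝ) :
    schrodinger d t (hS.toLp (diracMass d n ξ)) =ᵐ[surf d] fun η => evolution ξ n (t, η) := by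
  have hmem (k : ℕ) : zonalLp ξ (diracCoeff d n k • zonalOrtho d k) ∈
      eigenspace d (sphereEigenvalue d k) := by
    rw [map_smul]
    exact Submodule.smul_of_tower_mem _ _ (zonalLp_zonalOrtho_mem_eigenspace ξ k)
  rw [toLp_diracMass hd, diracPoly, map_sum, schrodinger_sum_of_mem_eigenspace _ hmem]
  simp only [zonalLp_apply, ← map_smul (ContinuousMap.toLp 2 (surf d) ℂ),
    ← map_sum (ContinuousMap.toLp 2 (surf d) ℂ)]
  refine (ContinuousMap.coeFn_toLp _ _).trans (.of_forall fun η => ?_)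
  simp only [ContinuousMap.sum_apply, ContinuousMap.smul_apply, zonalMap_apply, eval_smul,
    smul_eq_mul, evolution_apply, mul_comm (Complex.exp _)]

/-- The polynomial profile of the long-time average of `|exp (i t Δ) S_ξ^{(n)}|²`. -/
def averageDensityPoly (d n : ℕ) : ℝ[X] :=
  ∑ k ∈ Finset.range (n + 1), diracCoeff d n k ^ 2 • zonalOrtho d k ^ 2

/-- The long-time average of `|exp (i t Δ) S_ξ^{(n)}|²`. -/
def averageDensity (ξ : Sph d) (n : ℕ) : C(Sph d, ℝ) :=
  ⟨fun η => (averageDensityPoly d n).eval (dot ξ η), continuous_eval_dot _ ξ⟩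

theorem averageDensity_apply (ξ : Sph d) (n : ℕ) (η : Sph d) : averageDensity ξ n η =
    ∑ k ∈ Finset.range (n + 1), (diracCoeff d n k * (zonalOrtho d k).eval (dot ξ η)) ^ 2 := by
  simp [averageDensity, averageDensityPoly, eval_finsetSum, mul_pow]

theorem hasTimeAverage_norm_sq_evolution (hd : 3 ≤ d) (ξ : Sph d) (n : ℕ) (η : Sph d) :
    HasTimeAverage (fun t => ‖evolution ξ n (t, η)‖ ^ 2) (averageDensity ξ n η) := by
  simp only [averageDensity_apply, evolution_apply]
  exact hasTimeAverage_norm_sq_sum_mul_exp (sphereEigenvalue_injective hd).injOn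
    fun k => diracCoeff d n k * (zonalOrtho d k).eval (dot ξ η)

theorem hasTimeAverage_expectation (hd : 3 ≤ d) {n : ℕ} {ξ : Sph d}
    (hS : MemLp (diracMass d n ξ) 2 (surf d)) {a : Sph d → ℝ} (ha : Continuous a) :
    HasTimeAverage (fun t => expectation a (schrodinger d t (hS.toLp (diracMass d n ξ))))
      (∫ η, a η * averageDensity ξ n η ∂(surf d)) := by
  have hexp (t : ℝ) : expectation a (schrodinger d t (hS.toLp (diracMass d n ξ))) =
      ∫ η, a η * ‖evolution ξ n (t, η)‖ ^ 2 ∂(surf d) := by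
    refine integral_congr_ae ?_
    filter_upwards [schrodinger_diracMass_ae_eq hd hS t] with η hη
    rw [hη]
  simp only [hexp, averageDensity_apply, evolution_apply]
  refine hasTimeAverage_integral_mul_norm_sq_sum_mul_exp (sphereEigenvalue_injective hd).injOn
    fun j k => integrable_of_continuous ?_
  exact ha.mul (((continuous_eval_dot _ ξ).const_mul _).mul
    ((continuous_eval_dot _ ξ).const_mul _))

theorem integral_eval_dot_mul_averageDensity (q : ℝ[X]) (ξ : Sph d) (n : ℕ) :
    ∫ η, q.eval (dot ξ η) * averageDensity ξ n η ∂(surf d) =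
      ∑ k ∈ Finset.range (n + 1), spectralWeight d n k * zonalMean ξ (q * zonalOrtho d k ^ 2) := by
  have h := integral_eval_dot (q * averageDensityPoly d n) ξ
  simp only [eval_mul] at h
  refine h.trans ?_
  simp only [averageDensityPoly, Finset.mul_sum, map_sum, mul_smul_comm, map_smul, smul_eq_mul,
    spectralWeight, mul_assoc]

theorem integral_averageDensity (hd : 3 ≤ d) (ξ : Sph d) (n : ℕ) :
    ∫ η, averageDensity ξ n η ∂(surf d) = 1 := by
  simpa [zonalMean_sq hd, sum_spectralWeight hd] using
    integral_eval_dot_mul_averageDensity 1 ξ n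

theorem tendsto_integral_dot_sq_mul_averageDensity (hd : 3 ≤ d) (ξ : Sph d) :
    Tendsto (fun n => ∫ η, dot ξ η ^ 2 * averageDensity ξ n η ∂(surf d)) atTop (𝓝 (1 / 2)) := by
  have hmoment (n : ℕ) := integral_eval_dot_mul_averageDensity (X ^ 2) ξ n
  simp only [eval_pow, eval_X] at hmoment
  simp only [hmoment]
  exact tendsto_sum_mul_nhds (spectralWeight_nonneg d) (sum_spectralWeight hd)
    (tendsto_spectralWeight hd) (tendsto_zonalMean_X_sq_mul_sq hd ξ)

theorem averageDensity_eq (hd : 3 ≤ d) (ξ : Sph d) (n : ℕ) (η : Sph d) : averageDensity ξ n η =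
    ∑ k ∈ Finset.range (n + 1),
      spectralWeight d n k * ((zonalOrtho d k).eval (dot ξ η) ^ 2 / (surf d).real Set.univ) := by
  have hS := surf_real_univ_pos (by omega : 0 < d)
  rw [averageDensity_apply]
  refine Finset.sum_congr rfl fun k _ => ?_
  rw [spectralWeight]
  field_simp

theorem tendsto_averageDensity_of_dot_sq_eq_one (hd : 3 ≤ d) {ξ η : Sph d}
    (h : dot ξ η ^ 2 = 1) : Tendsto (fun n => averageDensity ξ n η) atTop atTop := by
  simp only [averageDensity_eq hd, zonalOrtho_eval_sq_of_sq_eq_one hd h]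
  exact tendsto_sum_mul_atTop (spectralWeight_nonneg d) (sum_spectralWeight hd)
    (tendsto_spectralWeight hd)
    ((tendsto_harmDim hd).atTop_div_const (surf_real_univ_pos (by omega)))

theorem bddAbove_range_averageDensity (hd : 3 ≤ d) {ξ η : Sph d} (h : |dot ξ η| < 1) :
    BddAbove (Set.range fun n => averageDensity ξ n η) := by
  obtain ⟨C, hC⟩ := bddAbove_range_zonalOrtho_eval_sq hd h
  refine ⟨C / (surf d).real Set.univ, Set.forall_mem_range.mpr fun n => ?_⟩
  calc averageDensity ξ n η
      ≤ ∑ k ∈ Finset.range (n + 1), spectralWeight d n k * (C / (surf d).real Set.univ) := by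
        rw [averageDensity_eq hd]
        gcongr with k
        · exact spectralWeight_nonneg d n k
        · exact hC ⟨k, rfl⟩
    _ = C / (surf d).real Set.univ := by rw [← Finset.sum_mul, sum_spectralWeight hd, one_mul]

end Evolution

end SphereFlow

end

theorem mainTheorem6_general (d : ℕ) (hd : 3 ≤ d) (ξ : Sph d) :
    (∀ f : C(Sph d, ℂ), TendstoUniformly
      (fun (n : ℕ) (ζ : Sph d) => ∫ η, (diracKernel d n ζ η : ℂ) * f η ∂(surf d)) f atTop) ∧
    ∃ hS : ∀ n : ℕ, MemLp (diracMass d n ξ) 2 (surf d),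
    (∀ n, ‖(hS n).toLp (diracMass d n ξ)‖ = 1) ∧
    (∃ (v : ℕ → C(ℝ × Sph d, ℂ)) (p : ℕ → C(Sph d, ℝ)),
      (∀ n t, ∀ᵐ η ∂(surf d),
        schrodinger d t ((hS n).toLp (diracMass d n ξ)) η = v n (t, η)) ∧
      (∀ n η, HasTimeAverage (fun t => ‖v n (t, η)‖ ^ 2) (p n η)) ∧
      (∀ n, ∫ η, p n η ∂(surf d) = 1) ∧
      (¬ ∀ a : C(Sph d, ℝ), Tendsto (fun n => ∫ η, a η * p n η ∂(surf d))
        atTop (𝓝 (⨍ η, a η ∂(surf d)))) ∧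
      Tendsto (fun n => p n ξ) atTop atTop ∧
      Tendsto (fun n => p n (-ξ)) atTop atTop ∧
      (∀ η, η ≠ ξ → η ≠ -ξ → ∃ C : ℝ, ∀ n, p n η ≤ C)) ∧
    ∃ A : ℕ → ℝ,
      (∀ n, HasTimeAverage (fun t => expectation (fun η => dot ξ η ^ 2)
        (schrodinger d t ((hS n).toLp (diracMass d n ξ)))) (A n)) ∧
      Tendsto A atTop (𝓝 (1 / 2)) ∧
      ⨍ η, dot ξ η ^ 2 ∂(surf d) = 1 / d := by
  have hcont : Continuous fun η : Sph d => dot ξ η ^ 2 := (continuous_dot_right ξ).pow 2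
  have hlim := tendsto_integral_dot_sq_mul_averageDensity hd ξ
  refine ⟨tendstoUniformly_integral_diracKernel hd, fun n => memLp_diracMass hd n ξ,
    fun n => norm_toLp_diracMass hd _,
    ⟨evolution ξ, averageDensity ξ, fun n => schrodinger_diracMass_ae_eq hd _,
      hasTimeAverage_norm_sq_evolution hd ξ, integral_averageDensity hd ξ, fun hequi => ?_,
      tendsto_averageDensity_of_dot_sq_eq_one hd (by rw [dot_self, one_pow]),
      tendsto_averageDensity_of_dot_sq_eq_one hd (by rw [dot_neg, dot_self, neg_one_sq]),
      fun η hne hne' => ?_⟩,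
    _, fun n => hasTimeAverage_expectation hd _ hcont, hlim, average_dot_sq hd ξ⟩
  · have hmean := tendsto_nhds_unique hlim (hequi ⟨fun η => dot ξ η ^ 2, hcont⟩)
    simp only [ContinuousMap.coe_mk, average_dot_sq hd] at hmean
    have hd' : (3 : ℝ) ≤ d := mod_cast hd
    field_simp at hmean
    linarith
  · obtain ⟨C, hC⟩ := bddAbove_range_averageDensity hd (abs_dot_lt_one_of_ne hne hne')
    exact ⟨C, fun n => hC ⟨n, rfl⟩⟩

theorem mainTheorem6 (d : ℕ) (hd : 3 ≤ d) (ξ : Sph d) :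
    -- the kernels `R_ζ^{(n)}`, of which the `S_ζ^{(n)}` are the normalizations, approximate `δ_ζ`
    (∀ f : C(Sph d, ℂ), TendstoUniformly
      (fun (n : ℕ) (ζ : Sph d) => ∫ η, (diracKernel d n ζ η : ℂ) * f η ∂(surf d)) f atTop) ∧
    -- `S_ξ^{(n)}` is normalized in `L²`
    ∃ hS : ∀ n : ℕ, MemLp (diracMass d n ξ) 2 (surf d),
    (∀ n, ‖(hS n).toLp (diracMass d n ξ)‖ = 1) ∧
    -- `v n (t, ·)` is the continuous version of `exp (i t Δ) S_ξ^{(n)}`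
    (∃ (v : ℕ → C(ℝ × Sph d, ℂ)) (p : ℕ → C(Sph d, ℝ)),
      (∀ n t, ∀ᵐ η ∂(surf d),
        schrodinger d t ((hS n).toLp (diracMass d n ξ)) η = v n (t, η)) ∧
      -- `p n` is the long-time average of its density, and a probability density
      (∀ n η, Tendsto (fun T : ℝ => 1 / T * ∫ t in (0 : ℝ)..T, ‖v n (t, η)‖ ^ 2)
        atTop (𝓝 (p n η))) ∧
      (∀ n, ∫ η, p n η ∂(surf d) = 1) ∧
      -- no equidistribution
      (¬ ∀ a : C(Sph d, ℝ), Tendsto (fun n => ∫ η, a η * p n η ∂(surf d))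
        atTop (𝓝 (⨍ η, a η ∂(surf d)))) ∧
      -- divergence at `± ξ`, boundedness elsewhere
      Tendsto (fun n => p n ξ) atTop atTop ∧
      Tendsto (fun n => p n (-ξ)) atTop atTop ∧
      (∀ η, η ≠ ξ → η ≠ -ξ → ∃ C : ℝ, ∀ n, p n η ≤ C)) ∧
    -- the observable `a(η) = (ξ · η)²` for `d = 3`
    (d = 3 →
      ∃ A : ℕ → ℝ,
        (∀ n, Tendsto (fun T : ℝ => 1 / T * ∫ t in (0 : ℝ)..T,
            expectation (fun η => dot ξ η ^ 2)
              (schrodinger d t ((hS n).toLp (diracMass d n ξ))))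
          atTop (𝓝 (A n))) ∧
        ((1 / 2 : ℝ) : EReal) ≤ liminf (fun n => (A n : EReal)) atTop ∧
        ⨍ η, dot ξ η ^ 2 ∂(surf d) = 1 / 3 ∧
        ¬ Tendsto A atTop (𝓝 (⨍ η, dot ξ η ^ 2 ∂(surf d)))) := by
  obtain ⟨hdirac, hS, hnorm, hdensity, A, hA, hlim, hmean⟩ := mainTheorem6_general d hd ξ
  refine ⟨hdirac, hS, hnorm, hdensity, ?_⟩
  rintro rfl
  rw [Nat.cast_ofNat] at hmean
  refine ⟨A, hA, ?_, hmean, fun hequi => ?_⟩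
  · exact ((continuous_coe_real_ereal.tendsto _).comp hlim).liminf_eq.ge
  · have hhalf := tendsto_nhds_unique hlim hequi
    norm_num [hmean] at hhalf
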